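/- A *mixed state* on $\mathbb C^d$ is a positive semidefinite matrix $\rho\in\mathbb C^{d\times d}$ with $\operatorname{tr}\rho=1$. Write $F(\rho,\sigma)=\|\sqrt\rho\sqrt\sigma\|_1$ for the fidelity (with $\|\cdot\|_1$ the trace norm), $D_B(\rho,\sigma)=\sqrt{2(1-F(\rho,\sigma))}$ for the Bures distance, and $$D_{B\chi^2}(\rho\|\sigma)=\operatorname{tr}\bigl((\rho-\sigma)\,\Omega_\sigma(\rho-\sigma)\bigr)$$ for the Bures $\chi^2$-divergence, where $X=\Omega_\sigma(A)$ solves $\tfrac12(\sigma X+X\sigma)=A$. If $\sigma$ is not of full rank but the support of $\rho$ is contained in that of $\sigma$, then such an $X$ exists for $A=\rho-\sigma$ and the value does not depend on its choice; if the support of $\rho$ is not contained in that of $\sigma$, then $D_{B\chi^2}(\rho\|\sigma)=\infty$. **Theorem.** There is an absolute constant $C>0$ such that the following holds. Let $\sigma\in\mathbb C^{d\times d}$ be a mixed state (of any rank), let $\varepsilon>0$ and let $0<\delta\le 1/3$. Then there are a number $n\le C\,\frac d\varepsilon\,\log\frac1\delta$ and a two-outcome measurement (POVM) on $(\mathbb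 C^d)^{\otimes n}$ with outcomes "close" and "far" such that, for every mixed state $\rho\in\mathbb C^{d\times d}$, when the measurement is applied to $\rho^{\otimes n}$: 1. with probability at least $1-\delta$ the report is correct in the following sense: if it is "close" then $F(\rho,\sigma)\ge 1-\varepsilon$, and if it is "far" then $D_{B\chi^2}(\rho\|\sigma)>.49\,\varepsilon$; 2. if $D_{B\chi^2}(\rho\|\sigma)\le .49\,\varepsilon$, then the report is "close" with probability at least $1-\delta$; 3. if $D_B(\rho,\sigma)^2>.5\,\varepsilon$, then the report is "far" with probability at least $1-\delta$. In particular (take $\delta=1/3$) $n=O(d/\varepsilon)$ copies suffice for success probability $2/3$. -/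

import Mathlib

open scoped Matrix MatrixOrder ComplexOrder

noncomputable section

namespace QCert

/-- A mixed state on `ℂ^I`: a positive semidefinite matrix of trace one. -/
structure IsState {I : Type*} [Fintype I] (ρ : Matrix I I ℂ) : Prop where
  posSemidef : ρ.PosSemidef
  trace_eq_one : ρ.trace = 1

/-- The state `ρ^{⊗ n}` of `n` copies of `ρ`, as a matrix on `(ℂ^d)^{⊗ n}`, whose standard basis is
indexed by words `Fin n → Fin d`. -/
def copies {d : ℕ} (n : ℕ) (ρ : Matrix (Fin d) (Fin d) ℂ) :
    Matrix (Fin n → Fin d) (Fin n → Fin d) ℂ :=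
  Matrix.of fun x y => ∏ i, ρ (x i) (y i)

/-- A positive-operator valued measurement on `ℂ^I` with outcomes in a finite set `K`. -/
structure POVM (I K : Type*) [Fintype I] [DecidableEq I] [Fintype K] where
  op : K → Matrix I I ℂ
  posSemidef : ∀ k, (op k).PosSemidef
  sum_eq_one : ∑ k, op k = 1

/-- The probability that the outcome of the measurement `M`, applied to the state `ϱ`, lies in `S`:
outcome `k` has probability `tr (ϱ E_k)`. -/
def POVM.prob {I K : Type*} [Fintype I] [DecidableEq I] [Fintype K] (M : POVM I K)
    (ϱ : Matrix I I ℂ) (S : Set K) : ℝ :=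
  ∑ k, S.indicator (fun k => (ϱ * M.op k).trace.re) k

/-- The two possible reports of a test. -/
inductive Verdict
  | close
  | far
  deriving DecidableEq

instance : Fintype Verdict where
  elems := {Verdict.close, Verdict.far}
  complete v := by cases v <;> simp

/-- The trace norm `‖A‖₁ = tr √(A† A)`. -/
def traceNorm {d : ℕ} (A : Matrix (Fin d) (Fin d) ℂ) : ℝ :=
  (CFC.sqrt (Aᴴ * A)).trace.re

/-- The fidelity `‖√ρ √σ‖₁` (not squared). -/
def fidelity {d : ℕ} (ρ σ : Matrix (Fin d) (Fin d) ℂ) : ℝ :=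
  traceNorm (CFC.sqrt ρ * CFC.sqrt σ)

/-- The Bures distance. -/
def buresDist {d : ℕ} (ρ σ : Matrix (Fin d) (Fin d) ℂ) : ℝ :=
  √(2 * (1 - fidelity ρ σ))

/-- The operator `A ↦ (σ A + A σ) / 2`, which is `Ω_σ⁻¹` when `σ` has full rank. -/
def omegaInv {d : ℕ} (σ A : Matrix (Fin d) (Fin d) ℂ) : Matrix (Fin d) (Fin d) ℂ :=
  (1 / 2 : ℂ) • (σ * A + A * σ)

/-- The operator `Ω_σ`. For `σ` of full rank it is the inverse of `omegaInv σ`; in general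
`omega σ A` is a solution `X` of `(σ X + X σ) / 2 = A` whenever there is one. -/
def omega {d : ℕ} (σ : Matrix (Fin d) (Fin d) ℂ) :
    Matrix (Fin d) (Fin d) ℂ → Matrix (Fin d) (Fin d) ℂ :=
  Function.invFun (omegaInv σ)

/-- If the positive semidefinite `σ` satisfies `ker σ ⊆ ker A` (in particular if `σ` has full
rank), then the equation that defines `omega σ A` is solvable. -/
theorem omegaInv_omega {d : ℕ} {σ A : Matrix (Fin d) (Fin d) ℂ} (hσ : σ.PosSemidef)
    (hA : ∀ v, σ *ᵥ v = 0 → A *ᵥ v = 0) : omegaInv σ (omega σ A) = A := by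
  apply Function.invFun_eq
  set U : Matrix (Fin d) (Fin d) ℂ := (hσ.1.eigenvectorUnitary).1 with hU
  set β := hσ.1.eigenvalues with hβ
  set D : Matrix (Fin d) (Fin d) ℂ := Matrix.diagonal fun i => (β i : ℂ) with hD
  have hβ0 : ∀ i, 0 ≤ β i := hσ.eigenvalues_nonneg
  have h1 : Uᴴ * U = 1 := Unitary.coe_star_mul_self hσ.1.eigenvectorUnitary
  have h2 : U * Uᴴ = 1 := Unitary.coe_mul_star_self hσ.1.eigenvectorUnitary
  have hs : σ = U * D * Uᴴ := by
    have := hσ.1.spectral_theorem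
    rw [Unitary.conjStarAlgAut_apply] at this
    exact this
  have hsU : σ * U = U * D := by
    rw [hs, Matrix.mul_assoc, h1, Matrix.mul_one]
  set B := Uᴴ * A * U with hB
  have hB0 : ∀ i j, β j = 0 → B i j = 0 := by
    intro i j hj
    have hv : σ *ᵥ (U *ᵥ Pi.single j 1) = 0 := by
      rw [Matrix.mulVec_mulVec, hsU, ← Matrix.mulVec_mulVec, hD]
      simp [hj]
    have h3 : B *ᵥ Pi.single j 1 = 0 := by
      rw [hB, Matrix.mul_assoc, ← Matrix.mulVec_mulVec, ← Matrix.mulVec_mulVec, hA _ hv,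
        Matrix.mulVec_zero]
    have := congrFun h3 i
    simpa using this
  set Y : Matrix (Fin d) (Fin d) ℂ :=
    Matrix.of fun i j => (2 / ((β i : ℂ) + β j)) * B i j with hY
  have hDY : (1 / 2 : ℂ) • (D * Y + Y * D) = B := by
    ext i j
    simp only [hD, hY, Matrix.smul_apply, Matrix.add_apply, Matrix.diagonal_mul,
      Matrix.mul_diagonal, Matrix.of_apply, smul_eq_mul]
    by_cases h : β i + β j = 0
    · have hj : β j = 0 := by linarith [hβ0 i, hβ0 j]
      rw [hB0 i j hj]; ring
    · have h' : (β i : ℂ) + β j ≠ 0 := by exact_mod_cast h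
      field_simp
  refine ⟨U * Y * Uᴴ, ?_⟩
  have e1 : σ * (U * Y * Uᴴ) = U * (D * Y) * Uᴴ := by
    rw [← Matrix.mul_assoc, ← Matrix.mul_assoc, hsU]; simp only [Matrix.mul_assoc]
  have e2 : (U * Y * Uᴴ) * σ = U * (Y * D) * Uᴴ := by
    rw [hs]
    calc U * Y * Uᴴ * (U * D * Uᴴ) = U * Y * (Uᴴ * U) * D * Uᴴ := by
          simp only [Matrix.mul_assoc]
      _ = _ := by rw [h1]; simp only [Matrix.mul_assoc, Matrix.one_mul]
  have e3 : omegaInv σ (U * Y * Uᴴ) = U * B * Uᴴ := by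
    rw [omegaInv, e1, e2, ← hDY, ← Matrix.add_mul, ← Matrix.mul_add, Matrix.mul_smul,
      Matrix.smul_mul]
  rw [e3, hB]
  calc U * (Uᴴ * A * U) * Uᴴ = (U * Uᴴ) * A * (U * Uᴴ) := by simp only [Matrix.mul_assoc]
    _ = A := by rw [h2, Matrix.one_mul, Matrix.mul_one]

/-- The number `tr (A · Ω_σ A)` does not depend on the choice of the solution. -/
theorem trace_mul_omega {d : ℕ} {σ A X : Matrix (Fin d) (Fin d) ℂ} (hX : omegaInv σ X = A) :
    (A * omega σ A).trace = (A * X).trace := by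
  have h : omegaInv σ (omega σ A) = A := Function.invFun_eq ⟨X, hX⟩
  have key : ∀ P Q : Matrix (Fin d) (Fin d) ℂ,
      (omegaInv σ P * Q).trace = (omegaInv σ Q * P).trace := by
    intro P Q
    simp only [omegaInv, Matrix.smul_mul, Matrix.trace_smul, Matrix.add_mul, Matrix.trace_add]
    rw [Matrix.trace_mul_cycle σ P Q, Matrix.trace_mul_cycle P σ Q,
      Matrix.trace_mul_cycle Q P σ, Matrix.trace_mul_cycle Q σ P, add_comm,
      Matrix.trace_mul_cycle P Q σ]
  calc (A * omega σ A).trace = (omegaInv σ X * omega σ A).trace := by rw [hX]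
    _ = (omegaInv σ (omega σ A) * X).trace := key _ _
    _ = (A * X).trace := by rw [h]

open Classical in
/-- The Bures `χ²`-divergence `tr ((ρ - σ) · Ω_σ (ρ - σ))` of `ρ` from `σ`; it is `∞` if the support
of `ρ` is not contained in the support of `σ`, that is, unless `ker σ ⊆ ker ρ`. -/
def buresChiSq {d : ℕ} (ρ σ : Matrix (Fin d) (Fin d) ℂ) : EReal :=
  if ∀ v, σ *ᵥ v = 0 → ρ *ᵥ v = 0 then
    (((ρ - σ) * omega σ (ρ - σ)).trace.re : EReal)
  else ⊤

end QCert

end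

/-! Smooth `σ` to `(1 - η) σ + η 1/d` with `η = 1e-8 ε`, and rotate to an eigenbasis, so that it
becomes `D = diagonal b` with every `b i` at least `1e-8 ε / d`. Let `u` be the Bures
`χ²`-divergence of the rotated `ρ` from `D`. By `exists_smoothing`, `χ²(ρ‖σ) ≤ .49 ε` forces `u ≤
.491 ε`, and `D_B(ρ, σ)² > .5 ε` forces `u ≥ .499 ε`. The first is a weighted triangle inequality.
The second needs that the squared Bures distance is at most the `χ²`-divergence, which
`exists_purification` proves with an explicit purification. It remains to tell these two ranges of
`u` apart.

Since `Ω D = 1`, one has `tr (ρ Ω ρ) = 1 + u`, which is quadratic in `ρ` and so is the mean of an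
observable on pairs of copies. Summing it over the `k²` pairs from two groups of `k` copies gives
`swapObs` with weights `2 / (b i + b j)`, of mean `k² (1 + u)`. With `X = Ω (ρ - D)`, its variance
is at most `2 k³ tr (ρ X²) + k² W`: the terms of order `k³` that do not vanish with `u` cancel. The
bounds `trace_state_mul_sq_diagOmega_le` on `tr (ρ X²)` and `sum_weight_sq_le` on `W`, both using
the lower bound on `b`, show that `k` of order `d / ε` makes the standard deviation small against
the gap between the two ranges. Chebyshev's inequality (`exists_spectral_test`) then gives error
`1/16`, and a majority vote over `O(log (1/δ))` blocks gives error `δ` (`HasTest.amplify`). -/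

noncomputable section

namespace QCert

/-! ### Tensor products of matrices -/

/-- The tensor product `⨂ a, A a`, as a matrix indexed by words `J → I`. -/
def tensor {J I : Type*} [Fintype J] (A : J → Matrix I I ℂ) : Matrix (J → I) (J → I) ℂ :=
  Matrix.of fun x y => ∏ a, A a (x a) (y a)

theorem tensor_apply {J I : Type*} [Fintype J] (A : J → Matrix I I ℂ) (x y : J → I) :
    tensor A x y = ∏ a, A a (x a) (y a) := rfl

theorem tensor_mul {J I : Type*} [Fintype J] [DecidableEq J] [Fintype I]
    (A B : J → Matrix I I ℂ) : tensor A * tensor B = tensor fun a => A a * B a := by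
  ext x y
  simp only [Matrix.mul_apply, tensor_apply, ← Finset.prod_mul_distrib]
  exact (Fintype.prod_sum fun a z => A a (x a) z * B a z (y a)).symm

theorem trace_tensor {J I : Type*} [Fintype J] [DecidableEq J] [Fintype I]
    (A : J → Matrix I I ℂ) : (tensor A).trace = ∏ a, (A a).trace := by
  simp only [Matrix.trace, Matrix.diag_apply, tensor_apply]
  exact (Fintype.prod_sum fun a z => A a z z).symm

theorem tensor_one {J I : Type*} [Fintype J] [DecidableEq J] [DecidableEq I] :
    tensor (fun _ : J => (1 : Matrix I I ℂ)) = 1 := by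
  ext x y
  rw [tensor_apply]
  by_cases h : x = y
  · subst h; simp
  · obtain ⟨a, ha⟩ := Function.ne_iff.1 h
    rw [Matrix.one_apply_ne h]
    exact Finset.prod_eq_zero (Finset.mem_univ a) (Matrix.one_apply_ne ha)

theorem conjTranspose_tensor {J I : Type*} [Fintype J] (A : J → Matrix I I ℂ) :
    (tensor A)ᴴ = tensor fun a => (A a)ᴴ := by
  ext x y
  simp [tensor_apply, Matrix.conjTranspose_apply]

theorem posSemidef_tensor {J I : Type*} [Fintype J] [DecidableEq J] [Fintype I] [DecidableEq I]
    {A : J → Matrix I I ℂ} (hA : ∀ a, (A a).PosSemidef) : (tensor A).PosSemidef := by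
  have h : ∀ a, ∃ B : Matrix I I ℂ, A a = Bᴴ * B := fun a => by
    have := (Matrix.nonneg_iff_posSemidef.2 (hA a))
    obtain ⟨B, hB⟩ := CStarAlgebra.nonneg_iff_eq_star_mul_self.1 this
    exact ⟨B, hB⟩
  choose B hB using h
  have : tensor A = (tensor B)ᴴ * tensor B := by
    rw [conjTranspose_tensor, tensor_mul]
    congr 1
    funext a
    exact hB a
  rw [this]
  exact Matrix.posSemidef_conjTranspose_mul_self _

/-- With `F = 1 - E`, the summands are the effects of independent runs in which exactly the runs in
`s` reject; the identity shows that they form a measurement. -/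
theorem sum_powerset_tensor {J I : Type*} [Fintype J] [DecidableEq J]
    (E F : J → Matrix I I ℂ) :
    ∑ s : Finset J, tensor (fun a => if a ∈ s then E a else F a) =
      tensor fun a => E a + F a := by
  ext x y
  simp only [Matrix.sum_apply, tensor_apply, Matrix.add_apply]
  rw [Finset.prod_add, Finset.powerset_univ]
  refine Finset.sum_congr rfl fun s _ => ?_
  rw [← Finset.prod_mul_prod_compl s, Finset.compl_eq_univ_sdiff]
  congr 1
  · exact Finset.prod_congr rfl fun a ha => by rw [if_pos ha]
  · refine Finset.prod_congr rfl fun a ha => ?_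
    rw [if_neg (Finset.mem_sdiff.1 ha).2]

theorem IsState.tensor {J I : Type*} [Fintype J] [DecidableEq J] [Fintype I] [DecidableEq I]
    {A : J → Matrix I I ℂ} (hA : ∀ a, IsState (A a)) : IsState (QCert.tensor A) where
  posSemidef := posSemidef_tensor fun a => (hA a).posSemidef
  trace_eq_one := by
    rw [trace_tensor]
    exact Finset.prod_eq_one fun a _ => (hA a).trace_eq_one

theorem re_trace_mul_nonneg {I : Type*} [Fintype I] [DecidableEq I] {A B : Matrix I I ℂ}
    (hA : A.PosSemidef) (hB : B.PosSemidef) : 0 ≤ (A * B).trace.re := by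
  obtain ⟨C, hC⟩ := CStarAlgebra.nonneg_iff_eq_star_mul_self.1 (Matrix.nonneg_iff_posSemidef.2 hA)
  rw [hC, Matrix.star_eq_conjTranspose, Matrix.trace_mul_cycle, Matrix.trace_mul_cycle]
  have := (hB.mul_mul_conjTranspose_same C).trace_nonneg
  exact (Complex.le_def.1 this).1

theorem trace_mul_isHermitian_im {I : Type*} [Fintype I] {A B : Matrix I I ℂ}
    (hA : A.IsHermitian) (hB : B.IsHermitian) : (A * B).trace.im = 0 := by
  have h : star (A * B).trace = (A * B).trace := by
    rw [← Matrix.trace_conjTranspose, Matrix.conjTranspose_mul, hA.eq, hB.eq,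
      Matrix.trace_mul_comm]
  exact Complex.conj_eq_iff_im.1 h

/-! ### Two-outcome tests on copies of a state -/

/-- There is a two-outcome measurement on the copies of `ρ` indexed by `J` whose probability of
rejecting is at most `δ` if `P ρ`, and at least `1 - δ` if `Q ρ`. -/
def HasTest (J : Type*) {I : Type*} [Fintype J] [DecidableEq J] [Fintype I] [DecidableEq I]
    (P Q : Matrix I I ℂ → Prop) (δ : ℝ) : Prop :=
  ∃ E : Matrix (J → I) (J → I) ℂ, E.PosSemidef ∧ (1 - E).PosSemidef ∧
    ∀ ρ, IsState ρ →
      (P ρ → (tensor (fun _ : J => ρ) * E).trace.re ≤ δ) ∧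
      (Q ρ → 1 - δ ≤ (tensor (fun _ : J => ρ) * E).trace.re)

theorem trace_submatrix_mul_submatrix {I I' : Type*} [Fintype I] [Fintype I'] (e : I' ≃ I)
    (A B : Matrix I I ℂ) :
    (A.submatrix e e * B.submatrix e e).trace = (A * B).trace := by
  rw [Matrix.submatrix_mul_equiv]
  simp only [Matrix.trace, Matrix.diag_apply, Matrix.submatrix_apply]
  exact e.sum_comp fun i => (A * B) i i

theorem posSemidef_one_sub_submatrix {I I' : Type*} [Fintype I] [Fintype I'] [DecidableEq I]
    [DecidableEq I'] (e : I' ≃ I) {E : Matrix I I ℂ} (hE : (1 - E).PosSemidef) :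
    (1 - E.submatrix e e).PosSemidef := by
  have := hE.submatrix e
  rwa [Matrix.submatrix_sub, Pi.sub_apply, Pi.sub_apply, Matrix.submatrix_one_equiv] at this

theorem HasTest.congr {J J' I : Type*} [Fintype J] [DecidableEq J] [Fintype J'] [DecidableEq J']
    [Fintype I] [DecidableEq I] {P Q : Matrix I I ℂ → Prop} {δ : ℝ} (e : J ≃ J')
    (h : HasTest J P Q δ) : HasTest J' P Q δ := by
  obtain ⟨E, h0, h1, hE⟩ := h
  let f : (J' → I) ≃ (J → I) := Equiv.arrowCongr e.symm (Equiv.refl I)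
  refine ⟨E.submatrix f f, h0.submatrix f, posSemidef_one_sub_submatrix f h1, fun ρ hρ => ?_⟩
  have h2 : tensor (fun _ : J' => ρ) = (tensor (fun _ : J => ρ)).submatrix f f := by
    ext x y
    simp only [tensor_apply, Matrix.submatrix_apply]
    exact (e.prod_comp fun a => ρ (x a) (y a)).symm
  rw [h2, trace_submatrix_mul_submatrix]
  exact hE ρ hρ

theorem HasTest.mono {J I : Type*} [Fintype J] [DecidableEq J] [Fintype I] [DecidableEq I]
    {P Q P' Q' : Matrix I I ℂ → Prop} {δ δ' : ℝ} (h : HasTest J P Q δ)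
    (hP : ∀ ρ, IsState ρ → P' ρ → P ρ) (hQ : ∀ ρ, IsState ρ → Q' ρ → Q ρ) (hδ : δ ≤ δ') :
    HasTest J P' Q' δ' := by
  obtain ⟨E, h0, h1, hE⟩ := h
  exact ⟨E, h0, h1, fun ρ hρ => ⟨fun h => ((hE ρ hρ).1 (hP ρ hρ h)).trans hδ,
    fun h => by linarith [(hE ρ hρ).2 (hQ ρ hρ h)]⟩⟩

theorem IsState.conj {I : Type*} [Fintype I] [DecidableEq I] {ρ U : Matrix I I ℂ}
    (hρ : IsState ρ) (hU : U * Uᴴ = 1) : IsState (Uᴴ * ρ * U) where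
  posSemidef := hρ.posSemidef.conjTranspose_mul_mul_same U
  trace_eq_one := by
    rw [Matrix.trace_mul_cycle, hU, Matrix.one_mul, hρ.trace_eq_one]

/-- Rotating every copy by the same unitary transports a test, so the smoothed state may be assumed
diagonal. -/
theorem HasTest.conj {J I : Type*} [Fintype J] [DecidableEq J] [Fintype I] [DecidableEq I]
    {P Q : Matrix I I ℂ → Prop} {δ : ℝ} (h : HasTest J P Q δ) {U : Matrix I I ℂ}
    (hU : U * Uᴴ = 1) :
    HasTest J (fun ρ => P (Uᴴ * ρ * U)) (fun ρ => Q (Uᴴ * ρ * U)) δ := by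
  obtain ⟨E, h0, h1, hE⟩ := h
  let V := tensor fun _ : J => U
  have hV : V * Vᴴ = 1 := by
    simp only [V, conjTranspose_tensor, tensor_mul, hU, tensor_one]
  refine ⟨V * E * Vᴴ, h0.mul_mul_conjTranspose_same V, ?_, fun ρ hρ => ?_⟩
  · have := h1.mul_mul_conjTranspose_same V
    rwa [Matrix.mul_sub, Matrix.sub_mul, Matrix.mul_one, hV] at this
  · have h2 : (tensor (fun _ : J => ρ) * (V * E * Vᴴ)).trace =
        (tensor (fun _ : J => Uᴴ * ρ * U) * E).trace := by
      have h3 : tensor (fun _ : J => Uᴴ * ρ * U) = Vᴴ * tensor (fun _ : J => ρ) * V := by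
        simp only [V, conjTranspose_tensor, tensor_mul]
      rw [h3, ← Matrix.mul_assoc, Matrix.trace_mul_comm]
      simp only [Matrix.mul_assoc]
    rw [h2]
    exact hE _ (hρ.conj hU)

/-- Majority vote over `m` independent repetitions. -/
theorem HasTest.amplify {J I : Type*} [Fintype J] [DecidableEq J] [Fintype I] [DecidableEq I]
    {P Q : Matrix I I ℂ → Prop} (h : HasTest J P Q (1 / 16)) (m : ℕ) :
    HasTest (Fin m × J) P Q ((1 / 2) ^ m) := by
  obtain ⟨E, h0, h1, hE⟩ := h
  let T : Finset (Fin m) → Matrix (Fin m → J → I) (Fin m → J → I) ℂ := fun s =>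
    tensor fun a => if a ∈ s then E else 1 - E
  have hT : ∀ s, (T s).PosSemidef := fun s => posSemidef_tensor fun a => by
    split_ifs <;> assumption
  have hT1 : ∑ s, T s = 1 := by
    rw [sum_powerset_tensor]
    simp only [add_sub_cancel, tensor_one]
  -- Ties count as rejection; either way a wrong majority contains at least `m / 2` wrong runs.
  let S : Finset (Finset (Fin m)) := Finset.univ.filter fun s => m ≤ 2 * s.card
  have hS : ∑ s ∈ S, T s + ∑ s ∈ Sᶜ, T s = 1 := by
    rw [Finset.sum_add_sum_compl, hT1]
  have hS' : 1 - ∑ s ∈ S, T s = ∑ s ∈ Sᶜ, T s := by rw [← hS, add_sub_cancel_left]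
  let f : (Fin m × J → I) ≃ (Fin m → J → I) := Equiv.curry _ _ _
  refine ⟨(∑ s ∈ S, T s).submatrix f f, (Matrix.posSemidef_sum _ fun s _ => hT s).submatrix f,
    posSemidef_one_sub_submatrix f (hS' ▸ Matrix.posSemidef_sum _ fun s _ => hT s),
    fun ρ hρ => ?_⟩
  set τ := tensor fun _ : J => ρ with hτ
  have hτs : IsState τ := IsState.tensor fun _ => hρ
  have h2 : tensor (fun _ : Fin m × J => ρ) = (tensor (fun _ : Fin m => τ)).submatrix f f := by
    ext x y
    simp only [tensor_apply, Matrix.submatrix_apply, hτ, Fintype.prod_prod_type]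
    rfl
  rw [h2, trace_submatrix_mul_submatrix]
  set p := (τ * E).trace.re with hp
  have hpE : (τ * E).trace = p :=
    Complex.ext rfl (trace_mul_isHermitian_im hτs.posSemidef.1 h0.1)
  have hp0 : 0 ≤ p := re_trace_mul_nonneg hτs.posSemidef h0
  have hpF : (τ * (1 - E)).trace = ((1 - p : ℝ) : ℂ) := by
    rw [Matrix.mul_sub, Matrix.trace_sub, Matrix.mul_one, hτs.trace_eq_one, hpE]
    push_cast; rfl
  have hp1 : 0 ≤ 1 - p := by
    have := re_trace_mul_nonneg hτs.posSemidef h1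
    rwa [hpF, Complex.ofReal_re] at this
  have hTs : ∀ s, (tensor (fun _ : Fin m => τ) * T s).trace =
      ((p ^ s.card * (1 - p) ^ (m - s.card) : ℝ) : ℂ) := fun s => by
    rw [tensor_mul, trace_tensor, ← Finset.prod_mul_prod_compl s]
    rw [Finset.prod_congr rfl fun a ha => by rw [if_pos ha, hpE],
      Finset.prod_congr (s₁ := sᶜ) rfl fun a ha => by
        rw [if_neg (Finset.mem_compl.1 ha), hpF]]
    simp only [Finset.prod_const, Finset.card_compl, Fintype.card_fin]
    push_cast; rfl
  have hsum : ∀ S' : Finset (Finset (Fin m)),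
      (tensor (fun _ : Fin m => τ) * ∑ s ∈ S', T s).trace.re =
        ∑ s ∈ S', p ^ s.card * (1 - p) ^ (m - s.card) := fun S' => by
    rw [Matrix.mul_sum, Matrix.trace_sum, Complex.re_sum]
    exact Finset.sum_congr rfl fun s _ => by rw [hTs, Complex.ofReal_re]
  -- No binomial tail estimate is needed: there are at most `2 ^ m` patterns, and with error `1/16`
  -- per run each wrong pattern has probability at most `(1/16) ^ (m/2) = (1/4) ^ m`.
  have htail : ∀ S' : Finset (Finset (Fin m)),
      (∀ s ∈ S', p ^ s.card * (1 - p) ^ (m - s.card) ≤ (1 / 4) ^ m) →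
        ∑ s ∈ S', p ^ s.card * (1 - p) ^ (m - s.card) ≤ (1 / 2) ^ m := fun S' h => by
    refine (Finset.sum_le_card_nsmul _ _ _ h).trans ?_
    rw [nsmul_eq_mul]
    have h4 : (S'.card : ℝ) ≤ 2 ^ m := by
      have := Finset.card_le_univ S'
      rw [Fintype.card_finset, Fintype.card_fin] at this
      exact_mod_cast this
    calc (S'.card : ℝ) * (1 / 4) ^ m ≤ 2 ^ m * (1 / 4) ^ m := by gcongr
      _ = (1 / 2) ^ m := by rw [← mul_pow]; norm_num
  have hpow : ∀ (x : ℝ) (j : ℕ), 0 ≤ x → x ≤ 1 / 16 → m ≤ 2 * j → x ^ j ≤ (1 / 4) ^ m :=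
    fun x j hx0 hx hj => by
      calc x ^ j ≤ (1 / 16) ^ j := by gcongr
        _ = (1 / 4) ^ (2 * j) := by rw [pow_mul]; norm_num
        _ ≤ (1 / 4) ^ m := pow_le_pow_of_le_one (by norm_num) (by norm_num) hj
  constructor
  · intro hP
    have hp2 := (hE ρ hρ).1 hP
    rw [hsum]
    refine htail _ fun s hs => ?_
    have hs := (Finset.mem_filter.1 hs).2
    calc _ ≤ p ^ s.card * 1 := by
          gcongr
          exact pow_le_one₀ hp1 (by linarith)
      _ ≤ _ := by rw [mul_one]; exact hpow p _ hp0 hp2 hs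
  · intro hQ
    have hp2 := (hE ρ hρ).2 hQ
    have h3 : (tensor (fun _ : Fin m => τ) * ∑ s ∈ S, T s).trace.re +
        (tensor (fun _ : Fin m => τ) * ∑ s ∈ Sᶜ, T s).trace.re = 1 := by
      rw [← Complex.add_re, ← Matrix.trace_add, ← Matrix.mul_add, hS, Matrix.mul_one,
        (IsState.tensor fun _ => hτs).trace_eq_one, Complex.one_re]
    have h4 : (tensor (fun _ : Fin m => τ) * ∑ s ∈ Sᶜ, T s).trace.re ≤ (1 / 2) ^ m := by
      rw [hsum]
      refine htail _ fun s hs => ?_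
      have hs : 2 * s.card < m := by simpa [S] using hs
      calc _ ≤ 1 * (1 - p) ^ (m - s.card) := by
            gcongr
            exact pow_le_one₀ hp0 (by linarith)
        _ ≤ _ := by rw [one_mul]; exact hpow _ _ hp1 (by linarith) (by omega)
    linarith

/-! ### Spectral tests -/

theorem exists_unitary_diagonal {I : Type*} [Fintype I] [DecidableEq I] {M : Matrix I I ℂ}
    (hM : M.IsHermitian) : ∃ (U : Matrix I I ℂ) (l : I → ℝ), Uᴴ * U = 1 ∧ U * Uᴴ = 1 ∧
      M = U * Matrix.diagonal (fun i => (l i : ℂ)) * Uᴴ := by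
  refine ⟨(hM.eigenvectorUnitary).1, hM.eigenvalues,
    Unitary.coe_star_mul_self hM.eigenvectorUnitary,
    Unitary.coe_mul_star_self hM.eigenvectorUnitary, ?_⟩
  have := hM.spectral_theorem
  rw [Unitary.conjStarAlgAut_apply] at this
  exact this

/-- Chebyshev's inequality for the spectral measurement of the observable `M` with threshold `t`. -/
theorem exists_spectral_test {I : Type*} [Fintype I] [DecidableEq I] {M : Matrix I I ℂ}
    (hM : M.IsHermitian) (t : ℝ) :
    ∃ E : Matrix I I ℂ, E.PosSemidef ∧ (1 - E).PosSemidef ∧ ∀ ϱ, IsState ϱ →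
      ∀ q v : ℝ, (ϱ * M).trace.re = q → (ϱ * (M * M)).trace.re ≤ v + q ^ 2 →
        (q < t → (ϱ * E).trace.re ≤ v / (t - q) ^ 2) ∧
        (t < q → 1 - v / (q - t) ^ 2 ≤ (ϱ * E).trace.re) := by
  obtain ⟨U, l, h1, h2, hMU⟩ := exists_unitary_diagonal hM
  obtain ⟨F, hF⟩ : ∃ F : (ℝ → ℝ) → Matrix I I ℂ,
      ∀ f, F f = U * Matrix.diagonal (fun i => (f (l i) : ℂ)) * Uᴴ := ⟨_, fun _ => rfl⟩
  have hFM : M = F id := by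
    rw [hF]
    exact hMU
  have hFmul : ∀ f g, F f * F g = F (fun x => f x * g x) := fun f g => by
    simp only [hF]
    calc _ = U * (Matrix.diagonal (fun i => (f (l i) : ℂ)) * (Uᴴ * U) *
          Matrix.diagonal (fun i => (g (l i) : ℂ))) * Uᴴ := by simp only [Matrix.mul_assoc]
      _ = _ := by
        rw [h1, Matrix.mul_one, Matrix.diagonal_mul_diagonal]
        push_cast; rfl
  have hF1 : F (fun _ => 1) = 1 := by
    simp only [hF, Complex.ofReal_one, Matrix.diagonal_one, Matrix.mul_one, h2]
  have hFsub : ∀ f g, F f - F g = F (fun x => f x - g x) := fun f g => by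
    simp only [hF]
    rw [← Matrix.sub_mul, ← Matrix.mul_sub, Matrix.diagonal_sub]
    push_cast; rfl
  have hFpos : ∀ f, (∀ x, 0 ≤ f x) → (F f).PosSemidef := fun f hf => by
    rw [hF]
    refine Matrix.PosSemidef.mul_mul_conjTranspose_same (Matrix.PosSemidef.diagonal ?_) U
    intro i
    exact Complex.zero_le_real.2 (hf _)
  -- The indicator function of `[t, ∞)`; the effect `F e` is the spectral projection of `M` onto it.
  obtain ⟨e, he⟩ : ∃ e : ℝ → ℝ, ∀ x, e x = 1 ∧ t ≤ x ∨ e x = 0 ∧ x < t := by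
    refine ⟨fun x => if t ≤ x then 1 else 0, fun x => ?_⟩
    by_cases h : t ≤ x
    · exact Or.inl ⟨if_pos h, h⟩
    · exact Or.inr ⟨if_neg h, not_le.1 h⟩
  refine ⟨F e, hFpos _ fun x => by rcases he x with h | h <;> simp [h.1], ?_, ?_⟩
  · rw [← hF1, hFsub (fun _ => 1) e]
    exact hFpos _ fun x => by rcases he x with h | h <;> simp [h.1]
  intro ϱ hϱ q v hq hv
  let p : I → ℝ := fun i => ((Uᴴ * ϱ * U) i i).re
  have hp0 : ∀ i, 0 ≤ p i := fun i =>
    (Complex.le_def.1 (hϱ.posSemidef.conjTranspose_mul_mul_same U).diag_nonneg).1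
  have htr : ∀ f, (ϱ * F f).trace.re = ∑ i, p i * f (l i) := fun f => by
    have : (ϱ * F f).trace = (Uᴴ * ϱ * U * Matrix.diagonal fun i => (f (l i) : ℂ)).trace := by
      simp only [hF]
      rw [← Matrix.mul_assoc, Matrix.trace_mul_comm]
      simp only [Matrix.mul_assoc]
    rw [this]
    simp only [Matrix.trace, Matrix.diag_apply, Matrix.mul_diagonal, Complex.re_sum,
      Complex.re_mul_ofReal]
    rfl
  have hp1 : ∑ i, p i = 1 := by
    have := htr fun _ => 1
    simpa only [hF1, Matrix.mul_one, hϱ.trace_eq_one, Complex.one_re, mul_one] using this.symm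
  rw [hFM, htr] at hq
  rw [hFM, hFmul, htr fun x => id x * id x] at hv
  have hvar : ∑ i, p i * (l i - q) ^ 2 ≤ v := by
    have : ∑ i, p i * (l i - q) ^ 2 =
        ∑ i, p i * (id (l i) * id (l i)) - 2 * q * ∑ i, p i * id (l i) + q ^ 2 * ∑ i, p i := by
      rw [Finset.mul_sum, Finset.mul_sum, ← Finset.sum_sub_distrib, ← Finset.sum_add_distrib]
      exact Finset.sum_congr rfl fun i _ => by simp only [id]; ring
    rw [this, hq, hp1]
    linarith
  -- Chebyshev's inequality for the distribution `p` of the measured eigenvalue, used with `f = e`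
  -- and with `f = 1 - e`.
  have key : ∀ g : ℝ, 0 < g → ∀ f : ℝ → ℝ, (∀ x, g ^ 2 * f x ≤ (x - q) ^ 2) →
      ∑ i, p i * f (l i) ≤ v / g ^ 2 := fun g hg f hf => by
    rw [le_div_iff₀ (by positivity)]
    refine le_trans ?_ hvar
    rw [Finset.sum_mul]
    refine Finset.sum_le_sum fun i _ => ?_
    calc p i * f (l i) * g ^ 2 = p i * (g ^ 2 * f (l i)) := by ring
      _ ≤ _ := mul_le_mul_of_nonneg_left (hf _) (hp0 i)
  constructor
  · intro h
    rw [htr]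
    refine key _ (sub_pos.2 h) e fun x => ?_
    rcases he x with hx | hx
    · rw [hx.1, mul_one]
      exact pow_le_pow_left₀ (by linarith) (by linarith) 2
    · rw [hx.1, mul_zero]; positivity
  · intro h
    have h3 := key _ (sub_pos.2 h) (fun x => 1 - e x) fun x => by
      rcases he x with hx | hx
      · rw [hx.1, sub_self, mul_zero]; positivity
      · rw [hx.1, sub_zero, mul_one]
        nlinarith [hx.2]
    have h4 : ∑ i, p i * (1 - e (l i)) = 1 - ∑ i, p i * e (l i) := by
      simp only [mul_sub, mul_one, Finset.sum_sub_distrib, hp1]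
    rw [htr]
    linarith

/-! ### Collective observables -/

/-- The observable `A` on the tensor factor `a`. -/
def localObs {J I : Type*} [Fintype J] [DecidableEq J] [DecidableEq I] (a : J)
    (A : Matrix I I ℂ) : Matrix (J → I) (J → I) ℂ :=
  tensor (Function.update (fun _ => 1) a A)

/-- The sum of the observable `A` over all the tensor factors. -/
def collObs (J : Type*) {I : Type*} [Fintype J] [DecidableEq J] [DecidableEq I]
    (A : Matrix I I ℂ) : Matrix (J → I) (J → I) ℂ :=
  ∑ a, localObs a A

section collective

variable {J I : Type*} [Fintype J] [DecidableEq J] [Fintype I] [DecidableEq I]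

omit [Fintype I] in
theorem conjTranspose_collObs (A : Matrix I I ℂ) : (collObs J A)ᴴ = collObs J Aᴴ := by
  rw [collObs, Matrix.conjTranspose_sum]
  refine Finset.sum_congr rfl fun a _ => ?_
  rw [localObs, conjTranspose_tensor, localObs]
  congr 1
  funext b
  by_cases h : b = a
  · subst h; simp
  · simp [h]

theorem trace_mul_localObs {ρ : Matrix I I ℂ} (hρ : ρ.trace = 1) (a : J) (A : Matrix I I ℂ) :
    (tensor (fun _ : J => ρ) * localObs a A).trace = (ρ * A).trace := by
  rw [localObs, tensor_mul, trace_tensor, Finset.prod_eq_single a]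
  · simp
  · intro b _ hb
    simp [hb, hρ]
  · simp

theorem trace_mul_localObs_mul_localObs {ρ : Matrix I I ℂ} (hρ : ρ.trace = 1) (a b : J)
    (A B : Matrix I I ℂ) :
    (tensor (fun _ : J => ρ) * (localObs a A * localObs b B)).trace =
      if a = b then (ρ * (A * B)).trace else (ρ * A).trace * (ρ * B).trace := by
  rw [localObs, localObs, tensor_mul, tensor_mul, trace_tensor]
  split_ifs with h
  · subst h
    rw [Finset.prod_eq_single a]
    · simp
    · intro c _ hc
      simp [hc, hρ]
    · simp
  · rw [← Finset.prod_subset (Finset.subset_univ {a, b}), Finset.prod_pair h]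
    · simp [h, Ne.symm h]
    · intro c _ hc
      simp only [Finset.mem_insert, Finset.mem_singleton, not_or] at hc
      simp [hc.1, hc.2, hρ]

theorem trace_mul_collObs {ρ : Matrix I I ℂ} (hρ : ρ.trace = 1) (A : Matrix I I ℂ) :
    (tensor (fun _ : J => ρ) * collObs J A).trace = Fintype.card J * (ρ * A).trace := by
  rw [collObs, Matrix.mul_sum, Matrix.trace_sum,
    Finset.sum_congr rfl fun a _ => trace_mul_localObs hρ a A]
  simp

theorem trace_mul_collObs_mul_collObs {ρ : Matrix I I ℂ} (hρ : ρ.trace = 1)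
    (A B : Matrix I I ℂ) :
    (tensor (fun _ : J => ρ) * (collObs J A * collObs J B)).trace =
      Fintype.card J * (ρ * (A * B)).trace +
        Fintype.card J * (Fintype.card J - 1) * ((ρ * A).trace * (ρ * B).trace) := by
  have h : ∀ a b : J, (tensor (fun _ : J => ρ) * (localObs a A * localObs b B)).trace =
      (if a = b then (ρ * (A * B)).trace - (ρ * A).trace * (ρ * B).trace else 0) +
        (ρ * A).trace * (ρ * B).trace := fun a b => by
    rw [trace_mul_localObs_mul_localObs hρ]
    split_ifs <;> ring
  simp only [collObs, Finset.sum_mul, Finset.mul_sum, Matrix.trace_sum, h,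
    Finset.sum_add_distrib, Finset.sum_ite_eq', Finset.mem_univ, if_true,
    Finset.sum_const, Finset.card_univ, nsmul_eq_mul]
  ring

/-- The observable `∑ i j, w i j • E i j ⊗ E j i` on two groups of copies, where `E i j` is the
collective matrix unit. -/
def swapObs (J : Type*) [Fintype J] [DecidableEq J] (w : I → I → ℝ) :
    Matrix ((J → I) × (J → I)) ((J → I) × (J → I)) ℂ :=
  ∑ i, ∑ j, (w i j : ℂ) • Matrix.kronecker (collObs J (Matrix.single i j 1))
    (collObs J (Matrix.single j i 1))

theorem isHermitian_swapObs {w : I → I → ℝ} (hw : ∀ i j, w i j = w j i) :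
    (swapObs J w).IsHermitian := by
  rw [Matrix.IsHermitian, swapObs, Matrix.conjTranspose_sum, Finset.sum_comm]
  refine (Finset.sum_congr rfl fun i _ => ?_)
  rw [Matrix.conjTranspose_sum]
  refine (Finset.sum_congr rfl fun j _ => ?_)
  rw [Matrix.conjTranspose_smul, Matrix.kronecker, Matrix.conjTranspose_kronecker,
    conjTranspose_collObs, conjTranspose_collObs, hw]
  simp

theorem trace_mul_swapObs {ρ : Matrix I I ℂ} (hρ : ρ.trace = 1) (w : I → I → ℝ) :
    (Matrix.kronecker (tensor fun _ : J => ρ) (tensor fun _ : J => ρ) * swapObs J w).trace =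
      (Fintype.card J : ℂ) ^ 2 * ∑ i, ∑ j, w i j * (ρ i j * ρ j i) := by
  simp only [swapObs, Matrix.trace_sum, Matrix.mul_smul, Matrix.trace_smul,
    Matrix.kronecker, ← Matrix.mul_kronecker_mul, Matrix.trace_kronecker, trace_mul_collObs hρ,
    smul_eq_mul, Matrix.trace_mul_single, Finset.mul_sum, MulOpposite.op_one, one_smul]
  exact Finset.sum_congr rfl fun i _ => Finset.sum_congr rfl fun j _ => by ring

/-- Expand over two pairs of copies, one pair from each factor of the square. Pairs that share no
copy give the squared mean; pairs that share one copy, in either group, give the two equal cubic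
terms; equal pairs give the last sum. -/
theorem trace_mul_swapObs_mul_swapObs {ρ : Matrix I I ℂ} (hρ : ρ.trace = 1) {w : I → I → ℝ}
    (hw : ∀ i j, w i j = w j i) {k : ℂ} (hk : k = Fintype.card J) :
    (Matrix.kronecker (tensor fun _ : J => ρ) (tensor fun _ : J => ρ) *
      (swapObs J w * swapObs J w)).trace =
      k ^ 2 * (k - 1) ^ 2 * (∑ i, ∑ j, w i j * (ρ i j * ρ j i)) ^ 2 +
      2 * (k ^ 2 * (k - 1)) * ∑ i, ∑ j, ∑ l, ρ i j * (w j l * ρ j l) * (w l i * ρ l i) +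
      k ^ 2 * ∑ i, ∑ j, (w i j : ℂ) ^ 2 * (ρ i i * ρ j j) := by
  have h : ∀ i j k' l, (ρ * (Matrix.single i j (1 : ℂ) * Matrix.single k' l 1)).trace =
      if j = k' then ρ l i else 0 := fun i j k' l => by
    split_ifs with h
    · subst h
      rw [Matrix.single_mul_single_same]
      simp [Matrix.trace_mul_single]
    · rw [Matrix.single_mul_single_of_ne _ _ _ _ h]
      simp
  simp only [swapObs, Matrix.mul_sum, Finset.sum_mul, Matrix.trace_sum, Matrix.mul_smul,
    Matrix.smul_mul, Matrix.trace_smul, Matrix.kronecker, ← Matrix.mul_kronecker_mul,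
    Matrix.trace_kronecker, trace_mul_collObs_mul_collObs hρ, h,
    smul_eq_mul, Matrix.trace_mul_single, ← hk, MulOpposite.op_one, one_smul]
  have key : ∀ i j a b : I, (w a b : ℂ) * (w i j * (((k * if j = a then ρ b i else 0) +
      k * (k - 1) * (ρ j i * ρ b a)) * ((k * if i = b then ρ a j else 0) +
      k * (k - 1) * (ρ i j * ρ a b)))) =
      (if j = a then if i = b then k ^ 2 * (w a b * w i j * (ρ b i * ρ a j)) else 0 else 0) +
      (if j = a then k ^ 2 * (k - 1) * (w a b * w i j * (ρ b i * ρ i j * ρ a b)) else 0) +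
      (if i = b then k ^ 2 * (k - 1) * (w a b * w i j * (ρ j i * ρ b a * ρ a j)) else 0) +
      k ^ 2 * (k - 1) ^ 2 * (w i j * (ρ i j * ρ j i) * (w a b * (ρ a b * ρ b a))) :=
    fun i j a b => by split_ifs <;> ring
  simp only [key, Finset.sum_add_distrib]
  have hd : ∑ i, ∑ j, ∑ a, ∑ b, k ^ 2 * (k - 1) ^ 2 *
      (w i j * (ρ i j * ρ j i) * (w a b * (ρ a b * ρ b a))) =
      k ^ 2 * (k - 1) ^ 2 * (∑ i, ∑ j, w i j * (ρ i j * ρ j i)) ^ 2 := by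
    simp only [← Finset.mul_sum, ← Finset.sum_mul, sq (∑ i, ∑ j, _)]
  have hb : ∑ i, ∑ j, ∑ a, ∑ b, (if j = a then
      k ^ 2 * (k - 1) * (w a b * w i j * (ρ b i * ρ i j * ρ a b)) else 0) =
      k ^ 2 * (k - 1) * ∑ i, ∑ j, ∑ l, ρ i j * (w j l * ρ j l) * (w l i * ρ l i) := by
    have : ∀ i j : I, ∑ a, ∑ b, (if j = a then
        k ^ 2 * (k - 1) * (w a b * w i j * (ρ b i * ρ i j * ρ a b)) else 0) =
        ∑ b, k ^ 2 * (k - 1) * (w j b * w i j * (ρ b i * ρ i j * ρ j b)) := fun i j => by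
      rw [Finset.sum_comm]
      simp
    simp only [this, Finset.mul_sum]
    rw [Finset.sum_comm_cycle]
    exact Finset.sum_congr rfl fun i _ => Finset.sum_congr rfl fun j _ =>
      Finset.sum_congr rfl fun l _ => by ring
  have hc : ∑ i, ∑ j, ∑ a, ∑ b, (if i = b then
      k ^ 2 * (k - 1) * (w a b * w i j * (ρ j i * ρ b a * ρ a j)) else 0) =
      k ^ 2 * (k - 1) * ∑ i, ∑ j, ∑ l, ρ i j * (w j l * ρ j l) * (w l i * ρ l i) := by
    simp only [Finset.sum_ite_eq, Finset.mem_univ, if_true, Finset.mul_sum]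
    rw [Finset.sum_comm_cycle]
    rw [Finset.sum_congr rfl fun i _ => Finset.sum_comm]
    exact Finset.sum_congr rfl fun i _ => Finset.sum_congr rfl fun j _ =>
      Finset.sum_congr rfl fun l _ => by rw [hw l i, hw j l]; ring
  have ha : ∑ i, ∑ j, ∑ a, ∑ b, (if j = a then if i = b then
      k ^ 2 * (w a b * w i j * (ρ b i * ρ a j)) else 0 else 0) =
      k ^ 2 * ∑ i, ∑ j, (w i j : ℂ) ^ 2 * (ρ i i * ρ j j) := by
    rw [Finset.mul_sum]
    refine Finset.sum_congr rfl fun i _ => ?_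
    rw [Finset.mul_sum]
    refine Finset.sum_congr rfl fun j _ => ?_
    rw [Finset.sum_comm]
    simp only [Finset.sum_ite_eq, Finset.mem_univ, if_true]
    rw [hw j i]
    ring
  rw [ha, hb, hc, hd]
  ring

end collective

/-! ### The `χ²`-divergence from a diagonal state of full rank -/

/-- The Bures `χ²`-divergence of `ρ` from the state `diagonal b`, for positive `b`. -/
def diagChiSq {I : Type*} [Fintype I] [DecidableEq I] (b : I → ℝ) (ρ : Matrix I I ℂ) : ℝ :=
  ∑ i, ∑ j, 2 / (b i + b j) *
    Complex.normSq (ρ i j - Matrix.diagonal (fun i => (b i : ℂ)) i j)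

/-- The image of `A` under the operator `Ω` of the state `diagonal b`. -/
def diagOmega {I : Type*} (b : I → ℝ) (A : Matrix I I ℂ) : Matrix I I ℂ :=
  Matrix.of fun i j => ((2 / (b i + b j) : ℝ) : ℂ) * A i j

/-- Each squared eigenvalue is at most the sum of all of them: the Hilbert–Schmidt norm dominates
the operator norm. -/
theorem posSemidef_smul_one_sub {I : Type*} [Fintype I] [DecidableEq I] {X : Matrix I I ℂ}
    (hX : X.IsHermitian) {s : ℝ} (hs : 0 ≤ s) (h : (X * X).trace.re ≤ s ^ 2) :
    ((s : ℂ) • (1 : Matrix I I ℂ) - X).PosSemidef := by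
  obtain ⟨U, l, h1, h2, hXU⟩ := exists_unitary_diagonal hX
  have h3 : (X * X).trace.re = ∑ i, l i ^ 2 := by
    have : X * X = U * (Matrix.diagonal (fun i => (l i : ℂ)) *
        Matrix.diagonal (fun i => (l i : ℂ))) * Uᴴ := by
      rw [hXU]
      calc _ = U * (Matrix.diagonal (fun i => (l i : ℂ)) * (Uᴴ * U) *
            Matrix.diagonal (fun i => (l i : ℂ))) * Uᴴ := by simp only [Matrix.mul_assoc]
        _ = _ := by rw [h1, Matrix.mul_one]
    rw [this, Matrix.trace_mul_cycle, h1, Matrix.one_mul, Matrix.diagonal_mul_diagonal,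
      Matrix.trace_diagonal, Complex.re_sum]
    exact Finset.sum_congr rfl fun i _ => by rw [← Complex.ofReal_mul, Complex.ofReal_re, sq]
  have h4 : (s : ℂ) • (1 : Matrix I I ℂ) - X =
      U * Matrix.diagonal (fun i => ((s - l i : ℝ) : ℂ)) * Uᴴ := by
    have : Matrix.diagonal (fun i => ((s - l i : ℝ) : ℂ)) =
        (s : ℂ) • (1 : Matrix I I ℂ) - Matrix.diagonal (fun i => (l i : ℂ)) := by
      rw [Matrix.smul_one_eq_diagonal, Matrix.diagonal_sub]
      push_cast; rfl
    rw [this, Matrix.mul_sub, Matrix.sub_mul, ← hXU, Matrix.mul_smul, Matrix.smul_mul,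
      Matrix.mul_one, h2]
  rw [h4]
  refine Matrix.PosSemidef.mul_mul_conjTranspose_same (Matrix.PosSemidef.diagonal fun i => ?_) U
  refine Complex.zero_le_real.2 (sub_nonneg.2 (abs_le_of_sq_le_sq' ?_ hs).2)
  exact (Finset.single_le_sum (f := fun i => l i ^ 2) (fun i _ => sq_nonneg _)
    (Finset.mem_univ i)).trans (h3 ▸ h)

section diag

variable {I : Type*} [Fintype I] [DecidableEq I] {b : I → ℝ} {ρ : Matrix I I ℂ}

omit [DecidableEq I] in
theorem trace_mul_diagOmega {A : Matrix I I ℂ} (hA : A.IsHermitian) (b : I → ℝ) :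
    (A * diagOmega b A).trace =
      ((∑ i, ∑ j, 2 / (b i + b j) * Complex.normSq (A i j) : ℝ) : ℂ) := by
  simp only [Matrix.trace, Matrix.diag_apply, Matrix.mul_apply, diagOmega, Matrix.of_apply]
  push_cast
  refine Finset.sum_congr rfl fun i _ => Finset.sum_congr rfl fun j _ => ?_
  rw [← Complex.mul_conj, ← hA.apply j i, add_comm (b j : ℂ)]
  simp only [Complex.star_def]
  ring

omit [Fintype I] [DecidableEq I] in
theorem isHermitian_diagOmega {A : Matrix I I ℂ} (hA : A.IsHermitian) (b : I → ℝ) :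
    (diagOmega b A).IsHermitian := by
  ext i j
  rw [Matrix.conjTranspose_apply, diagOmega, Matrix.of_apply, Matrix.of_apply, star_mul',
    hA.apply, add_comm]
  simp

theorem diagonal_mul_diagOmega_add (hb : ∀ i, 0 < b i) (A : Matrix I I ℂ) :
    Matrix.diagonal (fun i => (b i : ℂ)) * diagOmega b A +
      diagOmega b A * Matrix.diagonal (fun i => (b i : ℂ)) = (2 : ℂ) • A := by
  ext i j
  simp only [Matrix.add_apply, Matrix.diagonal_mul, Matrix.mul_diagonal, diagOmega,
    Matrix.of_apply, Matrix.smul_apply, smul_eq_mul]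
  have : (b i : ℂ) + b j ≠ 0 := by exact_mod_cast (add_pos (hb i) (hb j)).ne'
  push_cast
  field_simp

-- One of the two factors `2 / (b i + b j)` is bounded by `β⁻¹`; the other remains as the weight of
-- the `χ²`-divergence.
omit [DecidableEq I] in
theorem trace_sq_diagOmega_le {A : Matrix I I ℂ} (hA : A.IsHermitian) {β : ℝ} (hβ : 0 < β)
    (hb : ∀ i, β ≤ b i) :
    (diagOmega b A * diagOmega b A).trace.re ≤
      β⁻¹ * ∑ i, ∑ j, 2 / (b i + b j) * Complex.normSq (A i j) := by
  have h : (diagOmega b A * diagOmega b A).trace =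
      ((∑ i, ∑ j, (2 / (b i + b j)) ^ 2 * Complex.normSq (A i j) : ℝ) : ℂ) := by
    simp only [Matrix.trace, Matrix.diag_apply, Matrix.mul_apply, diagOmega, Matrix.of_apply]
    push_cast
    refine Finset.sum_congr rfl fun i _ => Finset.sum_congr rfl fun j _ => ?_
    rw [← Complex.mul_conj, ← hA.apply j i, add_comm (b j : ℂ)]
    simp only [Complex.star_def]
    ring
  rw [h, Complex.ofReal_re, Finset.mul_sum]
  refine Finset.sum_le_sum fun i _ => ?_
  rw [Finset.mul_sum]
  refine Finset.sum_le_sum fun j _ => ?_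
  have h1 : 0 < b i + b j := by linarith [hb i, hb j]
  have h2 : 2 / (b i + b j) ≤ β⁻¹ := by
    rw [div_le_iff₀ h1, ← div_eq_inv_mul, le_div_iff₀ hβ]
    linarith [hb i, hb j]
  rw [sq, mul_assoc]
  exact mul_le_mul_of_nonneg_right h2
    (mul_nonneg (by positivity) (Complex.normSq_nonneg _))

/-- Write `ρ = D + A` and let `u = tr (A X)`. Tracing `D X + X D = 2 A` against `X` gives `tr (D X²)
= u`; tracing it against `X²` gives `tr (A X²) = tr (X D X · X)`. The latter is at most `s tr (X D
X) = s u`, because `X D X` is positive and `X ≤ s`, which follows from `tr X² ≤ u / β ≤ s²`. -/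
theorem trace_state_mul_sq_diagOmega_le (hρ : IsState ρ) {β : ℝ} (hβ : 0 < β)
    (hb : ∀ i, β ≤ b i) {s : ℝ} (hs : 0 ≤ s) (h : diagChiSq b ρ ≤ s ^ 2 * β) :
    (ρ * (diagOmega b (ρ - Matrix.diagonal fun i => (b i : ℂ)) *
      diagOmega b (ρ - Matrix.diagonal fun i => (b i : ℂ)))).trace.re ≤
      diagChiSq b ρ * (1 + s) := by
  set D := Matrix.diagonal fun i => (b i : ℂ) with hD
  set A := ρ - D with hAdef
  set X := diagOmega b A with hXdef
  have hb0 : ∀ i, 0 < b i := fun i => hβ.trans_le (hb i)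
  have hDH : D.IsHermitian := by
    rw [Matrix.IsHermitian, hD, Matrix.diagonal_conjTranspose]
    congr 1
    funext i
    simp
  have hA : A.IsHermitian := hρ.posSemidef.1.sub hDH
  have hX : X.IsHermitian := isHermitian_diagOmega hA b
  have hu : (A * X).trace = (diagChiSq b ρ : ℂ) := trace_mul_diagOmega hA b
  have hDX : D * X + X * D = (2 : ℂ) • A := diagonal_mul_diagOmega_add hb0 A
  have h2 : (D * (X * X)).trace = (diagChiSq b ρ : ℂ) := by
    have := congrArg (fun Z => (Z * X).trace) hDX
    simp only [Matrix.add_mul, Matrix.trace_add, Matrix.smul_mul, Matrix.trace_smul, hu,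
      smul_eq_mul] at this
    rw [Matrix.trace_mul_cycle X D X, Matrix.mul_assoc D X X,
      Matrix.trace_mul_comm (X * X) D] at this
    linear_combination this / 2
  have h3 : (A * (X * X)).trace = (D * (X * X * X)).trace := by
    have := congrArg (fun Z => (Z * (X * X)).trace) hDX
    simp only [Matrix.add_mul, Matrix.trace_add, Matrix.smul_mul, Matrix.trace_smul,
      smul_eq_mul] at this
    rw [Matrix.mul_assoc X D, Matrix.trace_mul_comm X, Matrix.mul_assoc D (X * X) X,
      Matrix.mul_assoc D X (X * X), ← Matrix.mul_assoc X X X] at this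
    linear_combination - this / 2
  have h4 : (X * X).trace.re ≤ s ^ 2 := by
    refine (trace_sq_diagOmega_le hA hβ hb).trans ?_
    change β⁻¹ * diagChiSq b ρ ≤ s ^ 2
    rw [inv_mul_le_iff₀ hβ]
    linarith
  have h5 := posSemidef_smul_one_sub hX hs h4
  have hDpos : D.PosSemidef := Matrix.PosSemidef.diagonal fun i =>
    Complex.zero_le_real.2 (hb0 i).le
  have h6 := re_trace_mul_nonneg (hDpos.conjTranspose_mul_mul_same X) h5
  have h8 : (X * D * X * ((s : ℂ) • (1 : Matrix I I ℂ) - X)).trace =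
      ((s * diagChiSq b ρ : ℝ) : ℂ) - (A * (X * X)).trace := by
    have h9 : (X * D * X).trace = (D * (X * X)).trace := by
      rw [Matrix.trace_mul_comm, ← Matrix.mul_assoc, Matrix.trace_mul_comm]
    have h10 : (X * D * X * X).trace = (D * (X * X * X)).trace := by
      rw [Matrix.mul_assoc, Matrix.mul_assoc, Matrix.trace_mul_comm]
      simp only [Matrix.mul_assoc]
    rw [Matrix.mul_sub, Matrix.mul_smul, Matrix.mul_one, Matrix.trace_sub, Matrix.trace_smul,
      h9, h10, h2, h3, smul_eq_mul, Complex.ofReal_mul]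
  rw [hX.eq, h8, Complex.sub_re, Complex.ofReal_re] at h6
  have h7 : (ρ * (X * X)).trace = (D * (X * X)).trace + (A * (X * X)).trace := by
    rw [← Matrix.trace_add, ← Matrix.add_mul, hAdef, add_sub_cancel]
  rw [h7, h2, Complex.add_re, Complex.ofReal_re]
  linarith

theorem diagChiSq_nonneg (hb : ∀ i, 0 < b i) (ρ : Matrix I I ℂ) : 0 ≤ diagChiSq b ρ :=
  Finset.sum_nonneg fun i _ => Finset.sum_nonneg fun j _ =>
    mul_nonneg (div_nonneg zero_le_two (add_pos (hb i) (hb j)).le) (Complex.normSq_nonneg _)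

/-- By AM-GM the squared weight is at most `1 / (b i * b j)`, so the double sum is at most the
square of `∑ ρ i i / b i`. This sum exceeds the dimension by `∑ (ρ i i - b i) / b i`, which
Cauchy–Schwarz controls by the diagonal part of the divergence. -/
theorem sum_weight_sq_le (hρ : IsState ρ) {β : ℝ} (hβ : 0 < β) (hb : ∀ i, β ≤ b i) :
    ∑ i, ∑ j, (2 / (b i + b j)) ^ 2 * ((ρ i i).re * (ρ j j).re) ≤
      2 * (Fintype.card I : ℝ) ^ 2 + 2 * Fintype.card I * (diagChiSq b ρ / β) := by
  have hb0 : ∀ i, 0 < b i := fun i => hβ.trans_le (hb i)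
  have hr : ∀ i, 0 ≤ (ρ i i).re := fun i =>
    (Complex.le_def.1 hρ.posSemidef.diag_nonneg).1
  have h1 : ∑ i, ∑ j, (2 / (b i + b j)) ^ 2 * ((ρ i i).re * (ρ j j).re) ≤
      (∑ i, (ρ i i).re / b i) ^ 2 := by
    rw [sq (∑ i, _), Finset.sum_mul_sum]
    refine Finset.sum_le_sum fun i _ => Finset.sum_le_sum fun j _ => ?_
    have hi := hb0 i
    have hj := hb0 j
    have : (2 / (b i + b j)) ^ 2 ≤ 1 / (b i * b j) := by
      rw [div_pow, div_le_div_iff₀ (by positivity) (by positivity)]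
      nlinarith [sq_nonneg (b i - b j)]
    calc _ ≤ 1 / (b i * b j) * ((ρ i i).re * (ρ j j).re) :=
          mul_le_mul_of_nonneg_right this (mul_nonneg (hr i) (hr j))
      _ = _ := by field_simp
  have h2 : ∑ i, (ρ i i).re / b i = Fintype.card I + ∑ i, ((ρ i i).re - b i) / b i := by
    rw [← Finset.card_univ, Finset.card_eq_sum_ones, Nat.cast_sum, ← Finset.sum_add_distrib]
    refine Finset.sum_congr rfl fun i _ => ?_
    have := (hb0 i).ne'
    push_cast
    field_simp
    ring
  have h3 : (∑ i, ((ρ i i).re - b i) / b i) ^ 2 ≤ Fintype.card I * (diagChiSq b ρ / β) := by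
    refine sq_sum_le_card_mul_sum_sq.trans ?_
    rw [Finset.card_univ]
    refine mul_le_mul_of_nonneg_left ?_ (Nat.cast_nonneg _)
    rw [diagChiSq, Finset.sum_div]
    refine Finset.sum_le_sum fun i _ => ?_
    have hi := hb0 i
    have h4 : 2 / (b i + b i) * Complex.normSq (ρ i i - Matrix.diagonal (fun i => (b i : ℂ)) i i) ≤
        ∑ j, 2 / (b i + b j) *
          Complex.normSq (ρ i j - Matrix.diagonal (fun i => (b i : ℂ)) i j) :=
      Finset.single_le_sum (f := fun j => 2 / (b i + b j) *
          Complex.normSq (ρ i j - Matrix.diagonal (fun i => (b i : ℂ)) i j))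
        (fun j _ => mul_nonneg (div_nonneg zero_le_two (add_pos (hb0 i) (hb0 j)).le)
          (Complex.normSq_nonneg _)) (Finset.mem_univ i)
    have h5 : ((ρ i i).re - b i) ^ 2 ≤
        Complex.normSq (ρ i i - Matrix.diagonal (fun i => (b i : ℂ)) i i) := by
      rw [Matrix.diagonal_apply_eq, Complex.normSq_apply, Complex.sub_re, Complex.ofReal_re]
      nlinarith [mul_self_nonneg (ρ i i - b i).im]
    calc (((ρ i i).re - b i) / b i) ^ 2
          = 2 / (b i + b i) * ((ρ i i).re - b i) ^ 2 / b i := by field_simp; ring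
      _ ≤ 2 / (b i + b i) * ((ρ i i).re - b i) ^ 2 / β :=
          div_le_div_of_nonneg_left (by positivity) hβ (hb i)
      _ ≤ _ := by
          gcongr
          exact le_trans (mul_le_mul_of_nonneg_left h5 (by positivity)) h4
  rw [h2] at h1
  nlinarith [sq_nonneg ((Fintype.card I : ℝ) - ∑ i, ((ρ i i).re - b i) / b i)]

/-! ### Mean and second moment of the swap observable with weights `2 / (b i + b j)` -/

omit [Fintype I] in
theorem diagOmega_diagonal (hb : ∀ i, 0 < b i) :
    diagOmega b (Matrix.diagonal fun i => (b i : ℂ)) = 1 := by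
  ext i j
  rw [diagOmega, Matrix.of_apply]
  by_cases h : i = j
  · subst h
    have : (b i : ℂ) ≠ 0 := by exact_mod_cast (hb i).ne'
    rw [Matrix.diagonal_apply_eq, Matrix.one_apply_eq]
    push_cast
    field_simp
    norm_num
  · rw [Matrix.diagonal_apply_ne _ h, Matrix.one_apply_ne h, mul_zero]

/-- The trace of `D X + X D = 2 (ρ - D)` is zero, so `tr (D X) = 0` and `ρ - D` may be replaced by
`ρ` in the divergence. -/
theorem trace_mul_diagOmega_sub (hρ : IsState ρ) (hb : ∀ i, 0 < b i) (hb1 : ∑ i, b i = 1) :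
    (ρ * diagOmega b (ρ - Matrix.diagonal fun i => (b i : ℂ))).trace = (diagChiSq b ρ : ℂ) := by
  set D := Matrix.diagonal fun i => (b i : ℂ) with hD
  have hDH : D.IsHermitian := by
    rw [Matrix.IsHermitian, hD, Matrix.diagonal_conjTranspose]
    congr 1
    funext i
    simp
  have hu : ((ρ - D) * diagOmega b (ρ - D)).trace = (diagChiSq b ρ : ℂ) :=
    trace_mul_diagOmega (hρ.posSemidef.1.sub hDH) b
  have h1 := congrArg Matrix.trace (diagonal_mul_diagOmega_add hb (ρ - D))
  have h2 : D.trace = 1 := by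
    rw [hD, Matrix.trace_diagonal, ← Complex.ofReal_sum, hb1, Complex.ofReal_one]
  rw [← hD, Matrix.trace_add, Matrix.trace_mul_comm _ D, Matrix.trace_smul, Matrix.trace_sub,
    hρ.trace_eq_one, h2, sub_self, smul_zero] at h1
  rw [Matrix.sub_mul, Matrix.trace_sub] at hu
  linear_combination hu + h1 / 2

omit [Fintype I] in
theorem diagOmega_eq_one_add (hb : ∀ i, 0 < b i) (ρ : Matrix I I ℂ) :
    diagOmega b ρ = 1 + diagOmega b (ρ - Matrix.diagonal fun i => (b i : ℂ)) := by
  rw [← diagOmega_diagonal hb]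
  ext i j
  simp only [diagOmega, Matrix.add_apply, Matrix.sub_apply, Matrix.of_apply]
  ring

theorem sum_weight_mul_eq (hρ : IsState ρ) (hb : ∀ i, 0 < b i) (hb1 : ∑ i, b i = 1) :
    ∑ i, ∑ j, ((2 / (b i + b j) : ℝ) : ℂ) * (ρ i j * ρ j i) = 1 + diagChiSq b ρ := by
  have h2 : (ρ * diagOmega b ρ).trace = 1 + diagChiSq b ρ := by
    rw [diagOmega_eq_one_add hb, Matrix.mul_add, Matrix.mul_one, Matrix.trace_add,
      hρ.trace_eq_one, trace_mul_diagOmega_sub hρ hb hb1]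
  rw [← h2]
  simp only [Matrix.trace, Matrix.diag_apply, Matrix.mul_apply, diagOmega, Matrix.of_apply]
  refine Finset.sum_congr rfl fun i _ => Finset.sum_congr rfl fun j _ => ?_
  rw [add_comm (b j)]
  ring

theorem trace_mul_swapObs_eq (hρ : IsState ρ) (hb : ∀ i, 0 < b i) (hb1 : ∑ i, b i = 1)
    (J : Type*) [Fintype J] [DecidableEq J] :
    (Matrix.kronecker (tensor fun _ : J => ρ) (tensor fun _ : J => ρ) *
      swapObs J fun i j => 2 / (b i + b j)).trace.re =
      (Fintype.card J : ℝ) ^ 2 * (1 + diagChiSq b ρ) := by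
  rw [trace_mul_swapObs hρ.trace_eq_one, sum_weight_mul_eq hρ hb hb1]
  norm_cast

theorem trace_mul_swapObs_sq_eq (hρ : IsState ρ) (hb : ∀ i, 0 < b i) (hb1 : ∑ i, b i = 1)
    (J : Type*) [Fintype J] [DecidableEq J] {k : ℝ} (hk : k = Fintype.card J) :
    (Matrix.kronecker (tensor fun _ : J => ρ) (tensor fun _ : J => ρ) *
      (swapObs J (fun i j => 2 / (b i + b j)) * swapObs J fun i j => 2 / (b i + b j))).trace.re =
      k ^ 2 * (k - 1) ^ 2 * (1 + diagChiSq b ρ) ^ 2 +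
      2 * (k ^ 2 * (k - 1)) * (1 + 2 * diagChiSq b ρ +
        (ρ * (diagOmega b (ρ - Matrix.diagonal fun i => (b i : ℂ)) *
          diagOmega b (ρ - Matrix.diagonal fun i => (b i : ℂ)))).trace.re) +
      k ^ 2 * ∑ i, ∑ j, (2 / (b i + b j)) ^ 2 * ((ρ i i).re * (ρ j j).re) := by
  have h1 := trace_mul_diagOmega_sub hρ hb hb1
  have h3 : ∑ i, ∑ j, ∑ l, ρ i j * (((2 / (b j + b l) : ℝ) : ℂ) * ρ j l) *
      (((2 / (b l + b i) : ℝ) : ℂ) * ρ l i) =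
      1 + 2 * diagChiSq b ρ + (ρ * (diagOmega b (ρ - Matrix.diagonal fun i => (b i : ℂ)) *
          diagOmega b (ρ - Matrix.diagonal fun i => (b i : ℂ)))).trace := by
    have h4 : (ρ * (diagOmega b ρ * diagOmega b ρ)).trace =
        1 + 2 * diagChiSq b ρ + (ρ * (diagOmega b (ρ - Matrix.diagonal fun i => (b i : ℂ)) *
          diagOmega b (ρ - Matrix.diagonal fun i => (b i : ℂ)))).trace := by
      rw [diagOmega_eq_one_add hb]
      simp only [Matrix.mul_add, Matrix.add_mul, Matrix.mul_one, Matrix.one_mul,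
        Matrix.trace_add, hρ.trace_eq_one, h1]
      ring
    rw [← h4]
    simp only [Matrix.trace, Matrix.diag_apply, Matrix.mul_apply, diagOmega, Matrix.of_apply,
      Finset.mul_sum]
    exact Finset.sum_congr rfl fun i _ => Finset.sum_congr rfl fun j _ =>
      Finset.sum_congr rfl fun l _ => by ring
  have h5 : ∑ i, ∑ j, ((2 / (b i + b j) : ℝ) : ℂ) ^ 2 * (ρ i i * ρ j j) =
      ((∑ i, ∑ j, (2 / (b i + b j)) ^ 2 * ((ρ i i).re * (ρ j j).re) : ℝ) : ℂ) := by
    have hr : ∀ i, ρ i i = ((ρ i i).re : ℂ) := fun i =>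
      (Complex.conj_eq_iff_re.1 (hρ.posSemidef.1.apply i i)).symm
    push_cast
    refine Finset.sum_congr rfl fun i _ => Finset.sum_congr rfl fun j _ => ?_
    rw [← hr i, ← hr j]
  rw [trace_mul_swapObs_mul_swapObs hρ.trace_eq_one (fun i j => by rw [add_comm])
    (k := (k : ℂ)) (by rw [hk]; norm_cast), sum_weight_mul_eq hρ hb hb1, h3, h5]
  have e1 : (k : ℂ) ^ 2 * ((k : ℂ) - 1) ^ 2 * (1 + (diagChiSq b ρ : ℂ)) ^ 2 =
      ((k ^ 2 * (k - 1) ^ 2 * (1 + diagChiSq b ρ) ^ 2 : ℝ) : ℂ) := by push_cast; rfl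
  have e2 : 2 * ((k : ℂ) ^ 2 * ((k : ℂ) - 1)) = ((2 * (k ^ 2 * (k - 1)) : ℝ) : ℂ) := by
    push_cast; rfl
  have e3 : 1 + 2 * (diagChiSq b ρ : ℂ) = ((1 + 2 * diagChiSq b ρ : ℝ) : ℂ) := by
    push_cast; rfl
  rw [e1, e2, e3, ← Complex.ofReal_pow k 2, Complex.add_re, Complex.add_re, Complex.ofReal_re,
    Complex.re_ofReal_mul, Complex.re_ofReal_mul, Complex.add_re, Complex.ofReal_re,
    Complex.ofReal_re]

/-! ### Numerical inequalities and the basic test -/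

theorem variance_bound {d ε u k t W : ℝ} (hd : 1 ≤ d) (hε : 0 < ε) (hu : 0 ≤ u)
    (hk : 1e16 * (d / ε) ≤ k) (ht : t ≤ u * (1 + d / ε * (u + 1e8 * ε) / 2))
    (hW : W ≤ 2 * d ^ 2 + 2 * d * (u / (1e-8 * ε / d))) :
    2 * k ^ 3 * t + k ^ 2 * W ≤ k ^ 4 * (1e-7 * (ε ^ 2 + u * ε + u ^ 2)) := by
  obtain ⟨x, hx⟩ : ∃ x, x = d / ε := ⟨_, rfl⟩
  have hdx : d = x * ε := by rw [hx]; field_simp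
  have hx0 : 0 < x := by rw [hx]; positivity
  rw [← hx] at hk ht
  have hk0 : 0 < k := lt_of_lt_of_le (by positivity) hk
  have hxk : x ≤ 1e-16 * k := by linarith
  have h1 : t ≤ x * (u * (1.1e8 * ε + u)) := by
    refine ht.trans ?_
    -- As `x * ε = d ≥ 1`, the constant term is absorbed, and `1.1e8` leaves room for it next to
    -- `1e8 / 2`.
    have : u * 1 ≤ u * (x * ε) := by gcongr; linarith
    nlinarith [mul_nonneg hu (mul_pos hx0 hε).le, mul_nonneg hx0.le (mul_nonneg hu hu)]
  have h2 : W ≤ x ^ 2 * (2 * ε ^ 2 + 2e8 * (ε * u)) := by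
    refine hW.trans (le_of_eq ?_)
    rw [hdx]
    field_simp
    ring
  have h3 : t ≤ 1e-16 * k * (u * (1.1e8 * ε + u)) :=
    h1.trans (mul_le_mul_of_nonneg_right hxk (by positivity))
  have h4 : W ≤ (1e-16 * k) ^ 2 * (2 * ε ^ 2 + 2e8 * (ε * u)) := by
    refine h2.trans (mul_le_mul_of_nonneg_right ?_ (by positivity))
    gcongr
  calc 2 * k ^ 3 * t + k ^ 2 * W ≤ 2 * k ^ 3 * (1e-16 * k * (u * (1.1e8 * ε + u))) +
        k ^ 2 * ((1e-16 * k) ^ 2 * (2 * ε ^ 2 + 2e8 * (ε * u))) := by gcongr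
    _ = k ^ 4 * (2.2e-8 * (u * ε) + 2e-16 * u ^ 2 + 2e-32 * ε ^ 2 + 2e-24 * (u * ε)) := by ring
    _ ≤ _ := by
      gcongr
      nlinarith [mul_nonneg hu hε.le, sq_nonneg u, sq_nonneg ε]

theorem gap_bound_low {ε u : ℝ} (hε : 0 < ε) (hu : 0 ≤ u) (h : u ≤ 0.491 * ε) :
    16 * (1e-7 * (ε ^ 2 + u * ε + u ^ 2)) ≤ (1 + 0.495 * ε - (1 + u)) ^ 2 := by
  have h1 : u * ε ≤ ε ^ 2 := by nlinarith
  have h2 : u ^ 2 ≤ ε ^ 2 := pow_le_pow_left₀ hu (by linarith) 2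
  have h3 : (0.004 * ε) ^ 2 ≤ (1 + 0.495 * ε - (1 + u)) ^ 2 :=
    pow_le_pow_left₀ (by positivity) (by linarith) 2
  nlinarith

theorem gap_bound_high {ε u : ℝ} (hε : 0 < ε) (h : 0.499 * ε ≤ u) :
    16 * (1e-7 * (ε ^ 2 + u * ε + u ^ 2)) ≤ (1 + u - (1 + 0.495 * ε)) ^ 2 := by
  have hu : 0 < u := by linarith
  have h1 : u * ε ≤ 2.1 * u ^ 2 := by nlinarith
  have h2 : ε ^ 2 ≤ (2.1 * u) ^ 2 := pow_le_pow_left₀ hε.le (by linarith) 2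
  have h3 : (0.008 * u) ^ 2 ≤ (1 + u - (1 + 0.495 * ε)) ^ 2 :=
    pow_le_pow_left₀ (by positivity) (by linarith) 2
  nlinarith

/-- A test for the `χ²`-divergence from a diagonal state whose eigenvalues are bounded below. -/
theorem hasTest_diagChiSq (hb1 : ∑ i, b i = 1) {ε : ℝ} (hε : 0 < ε) (hI : 0 < Fintype.card I)
    (hb : ∀ i, 1e-8 * ε / Fintype.card I ≤ b i) {k : ℕ} (hk : 1e16 * (Fintype.card I / ε) ≤ k) :
    HasTest (Fin k ⊕ Fin k) (fun ρ => diagChiSq b ρ ≤ 0.491 * ε)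
      (fun ρ => 0.499 * ε ≤ diagChiSq b ρ) (1 / 16) := by
  have hd1 : (1 : ℝ) ≤ Fintype.card I := by exact_mod_cast hI
  set d : ℝ := (Fintype.card I : ℝ) with hd
  have hd0 : 0 < d := by linarith
  have hβ : 0 < 1e-8 * ε / d := by positivity
  have hb0 : ∀ i, 0 < b i := fun i => hβ.trans_le (hb i)
  have hx : 0 < d / ε := by positivity
  have hk0 : (0 : ℝ) < k := lt_of_lt_of_le (by positivity) hk
  have hk1 : (1 : ℝ) ≤ k := by
    have : 0 < k := by exact_mod_cast hk0
    exact_mod_cast this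
  -- The threshold `0.495 * ε` is the midpoint of `0.491 * ε` and `0.499 * ε`.
  obtain ⟨E, h0, h1, hE⟩ := exists_spectral_test
    (isHermitian_swapObs (J := Fin k) (w := fun i j => 2 / (b i + b j))
      fun i j => by rw [add_comm]) ((k : ℝ) ^ 2 * (1 + 0.495 * ε))
  let f : (Fin k ⊕ Fin k → I) ≃ (Fin k → I) × (Fin k → I) := Equiv.sumArrowEquivProdArrow _ _ _
  refine ⟨E.submatrix f f, h0.submatrix f, posSemidef_one_sub_submatrix f h1, fun ρ hρ => ?_⟩
  have h2 : tensor (fun _ : Fin k ⊕ Fin k => ρ) =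
      (Matrix.kronecker (tensor fun _ : Fin k => ρ) (tensor fun _ : Fin k => ρ)).submatrix
        f f := by
    ext x y
    simp only [tensor_apply, Matrix.submatrix_apply, Fintype.prod_sum_type]
    rfl
  rw [h2, trace_submatrix_mul_submatrix]
  set ϱ := Matrix.kronecker (tensor fun _ : Fin k => ρ) (tensor fun _ : Fin k => ρ) with hϱ
  have hτ : IsState (tensor fun _ : Fin k => ρ) := IsState.tensor fun _ => hρ
  have hϱs : IsState ϱ := ⟨hτ.posSemidef.kronecker hτ.posSemidef, by
    rw [hϱ, Matrix.kronecker, Matrix.trace_kronecker, hτ.trace_eq_one, one_mul]⟩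
  have hm := trace_mul_swapObs_eq hρ hb0 hb1 (Fin k)
  rw [← hϱ, Fintype.card_fin] at hm
  have hv := trace_mul_swapObs_sq_eq hρ hb0 hb1 (Fin k) (k := k) (by rw [Fintype.card_fin])
  rw [← hϱ] at hv
  set u := diagChiSq b ρ with hu
  have hu0 : 0 ≤ u := diagChiSq_nonneg hb0 ρ
  -- An upper bound for `√(u / β)`, with `β = 1e-8 * ε / d`, that is polynomial in `u`: AM-GM for
  -- `u` and `1e8 * ε`, together with `d ≥ 1`.
  set s : ℝ := d / ε * (u + 1e8 * ε) / 2 with hs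
  have hs0 : 0 ≤ s := by positivity
  have ht := trace_state_mul_sq_diagOmega_le hρ hβ hb hs0 (by
    rw [← hu, hs]
    have : (d / ε * (u + 1e8 * ε) / 2) ^ 2 * (1e-8 * ε / d) =
      d * (1e-8 * (u + 1e8 * ε) ^ 2 / (4 * ε)) := by
      field_simp
      norm_num
    rw [this]
    have h3 : u ≤ 1e-8 * (u + 1e8 * ε) ^ 2 / (4 * ε) := by
      rw [le_div_iff₀ (by positivity)]
      nlinarith [sq_nonneg (u - 1e8 * ε)]
    exact h3.trans (le_mul_of_one_le_left (by positivity) hd1))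
  have hW := sum_weight_sq_le hρ hβ hb
  rw [← hu] at ht hW
  set t := (ρ * (diagOmega b (ρ - Matrix.diagonal fun i => (b i : ℂ)) *
    diagOmega b (ρ - Matrix.diagonal fun i => (b i : ℂ)))).trace.re with htdef
  set W := ∑ i, ∑ j, (2 / (b i + b j)) ^ 2 * ((ρ i i).re * (ρ j j).re) with hWdef
  have ht0 : 0 ≤ t := by
    have hX := isHermitian_diagOmega (hρ.posSemidef.1.sub
      (Matrix.isHermitian_diagonal_of_self_adjoint (fun i => (b i : ℂ))
        (funext fun i => Complex.conj_ofReal (b i)))) b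
    refine re_trace_mul_nonneg hρ.posSemidef ?_
    have := Matrix.posSemidef_conjTranspose_mul_self
      (diagOmega b (ρ - Matrix.diagonal fun i => (b i : ℂ)))
    rwa [hX.eq] at this
  have hv' : (ϱ * (swapObs (Fin k) (fun i j => 2 / (b i + b j)) *
      swapObs (Fin k) fun i j => 2 / (b i + b j))).trace.re ≤
      (2 * (k : ℝ) ^ 3 * t + (k : ℝ) ^ 2 * W) + ((k : ℝ) ^ 2 * (1 + u)) ^ 2 := by
    rw [hv]
    -- Exactly the slack in the variance bound. The cancellation comes from `1 + 2u = (1 + u)² -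
    -- u²`.
    have : 0 ≤ (k : ℝ) ^ 2 * ((1 + u) ^ 2 + 2 * (k - 1) * u ^ 2 + 2 * t) := by
      have : (0 : ℝ) ≤ k - 1 := by linarith
      positivity
    linarith
  have hbound : 2 * (k : ℝ) ^ 3 * t + (k : ℝ) ^ 2 * W ≤
      (k : ℝ) ^ 4 * (1e-7 * (ε ^ 2 + u * ε + u ^ 2)) :=
    variance_bound hd1 hε hu0 hk ht hW
  obtain ⟨hlow, hhigh⟩ := hE ϱ hϱs _ _ hm hv'
  have hdiv : ∀ x y : ℝ, x ≠ y → 16 * (1e-7 * (ε ^ 2 + u * ε + u ^ 2)) ≤ (x - y) ^ 2 →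
      (2 * (k : ℝ) ^ 3 * t + (k : ℝ) ^ 2 * W) / ((k : ℝ) ^ 2 * x - (k : ℝ) ^ 2 * y) ^ 2 ≤
        1 / 16 := fun x y hxy h => by
    have h4 : 0 < (x - y) ^ 2 := by
      have := sub_ne_zero.2 hxy
      positivity
    rw [← mul_sub, mul_pow, ← pow_mul, div_le_iff₀ (by positivity)]
    refine hbound.trans ?_
    have := mul_le_mul_of_nonneg_left h (pow_nonneg hk0.le 4)
    linarith
  constructor
  · intro h
    change u ≤ _ at h
    exact (hlow (by gcongr ?_ * ?_; linarith)).trans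
      (hdiv _ _ (by linarith) (gap_bound_low hε hu0 h))
  · intro h
    change _ ≤ u at h
    have := hdiv (1 + u) (1 + 0.495 * ε) (by linarith) (gap_bound_high hε h)
    exact (sub_le_sub_left this 1).trans (hhigh (by gcongr ?_ * ?_; linarith))

end diag

/-! ### The Bures distance, the `χ²`-divergence, and mixing with the maximally mixed state -/

/-- Young's inequality with parameter `1000`. The loss of a factor `1.001` fits between `.49` and
`.491` and between `.499` and `.5`; the factor `1001` falls on errors of order `η`. -/
theorem normSq_add_le (x y : ℂ) :
    Complex.normSq (x + y) ≤ 1.001 * Complex.normSq x + 1001 * Complex.normSq y := by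
  simp only [Complex.normSq_apply, Complex.add_re, Complex.add_im]
  nlinarith [sq_nonneg (x.re - 1000 * y.re), sq_nonneg (x.im - 1000 * y.im)]

/-! ### Trace norm, fidelity and purifications -/

theorem trace_conjTranspose_mul_self {I : Type*} [Fintype I] (M : Matrix I I ℂ) :
    (Mᴴ * M).trace.re = ∑ i, ∑ j, Complex.normSq (M i j) := by
  simp only [Matrix.trace, Matrix.diag_apply, Matrix.mul_apply, Matrix.conjTranspose_apply,
    Complex.re_sum]
  rw [Finset.sum_comm]
  refine Finset.sum_congr rfl fun i _ => Finset.sum_congr rfl fun j _ => ?_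
  rw [Complex.star_def, Complex.normSq_eq_conj_mul_self.symm, Complex.ofReal_re]

/-- In an eigenbasis of `|M|`, the `i`-th column of `M` has norm equal to the `i`-th eigenvalue of
`|M|`, which therefore bounds the diagonal entry. -/
theorem re_trace_le_traceNorm {d : ℕ} (M : Matrix (Fin d) (Fin d) ℂ) :
    M.trace.re ≤ traceNorm M := by
  set H := CFC.sqrt (Mᴴ * M) with hH
  have hMM : 0 ≤ Mᴴ * M :=
    Matrix.nonneg_iff_posSemidef.2 (Matrix.posSemidef_conjTranspose_mul_self M)
  have hHH : H * H = Mᴴ * M := CFC.sqrt_mul_sqrt_self _ hMM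
  have hHpos : H.PosSemidef := Matrix.nonneg_iff_posSemidef.1 (CFC.sqrt_nonneg _)
  obtain ⟨V, l, h1, h2, hV⟩ := exists_unitary_diagonal hHpos.1
  have hVH : Vᴴ * H * V = Matrix.diagonal fun i => (l i : ℂ) := by
    rw [hV]
    calc _ = (Vᴴ * V) * Matrix.diagonal (fun i => (l i : ℂ)) * (Vᴴ * V) := by
          simp only [Matrix.mul_assoc]
      _ = _ := by rw [h1, Matrix.one_mul, Matrix.mul_one]
  have hl : ∀ i, 0 ≤ l i := fun i => by
    have := (hHpos.conjTranspose_mul_mul_same V).diag_nonneg (i := i)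
    rw [hVH, Matrix.diagonal_apply_eq] at this
    exact Complex.zero_le_real.1 this
  have htr : ∀ Z : Matrix (Fin d) (Fin d) ℂ, Z.trace = (Vᴴ * Z * V).trace := fun Z => by
    rw [Matrix.trace_mul_cycle, h2, Matrix.one_mul]
  set Y := Vᴴ * M * V with hY
  have hYY : Yᴴ * Y = Matrix.diagonal fun i => ((l i ^ 2 : ℝ) : ℂ) := by
    calc Yᴴ * Y = Vᴴ * Mᴴ * (V * Vᴴ) * M * V := by
          simp only [hY, Matrix.conjTranspose_mul, Matrix.conjTranspose_conjTranspose,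
            Matrix.mul_assoc]
      _ = Vᴴ * (H * H) * V := by rw [h2, Matrix.mul_one, hHH]; simp only [Matrix.mul_assoc]
      _ = (Vᴴ * H * (V * Vᴴ)) * H * V := by rw [h2, Matrix.mul_one]; simp only [Matrix.mul_assoc]
      _ = (Vᴴ * H * V) * (Vᴴ * H * V) := by simp only [Matrix.mul_assoc]
      _ = _ := by
        rw [hVH, Matrix.diagonal_mul_diagonal]
        congr 1
        funext i
        push_cast
        ring
  change M.trace.re ≤ H.trace.re
  rw [htr M, htr H, hVH, Matrix.trace_diagonal, Matrix.trace, Complex.re_sum, Complex.re_sum]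
  refine Finset.sum_le_sum fun i _ => ?_
  rw [Matrix.diag_apply, Complex.ofReal_re]
  refine (abs_le_of_sq_le_sq' ?_ (hl i)).2
  have h3 : ((Yᴴ * Y) i i).re = ∑ j, Complex.normSq (Y j i) := by
    rw [Matrix.mul_apply, Complex.re_sum]
    refine Finset.sum_congr rfl fun j _ => ?_
    rw [Matrix.conjTranspose_apply, Complex.star_def, ← Complex.normSq_eq_conj_mul_self,
      Complex.ofReal_re]
  rw [hYY, Matrix.diagonal_apply_eq, Complex.ofReal_re] at h3
  rw [h3]
  refine le_trans ?_ (Finset.single_le_sum (f := fun j => Complex.normSq (Y j i))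
    (fun j _ => Complex.normSq_nonneg _) (Finset.mem_univ i))
  rw [Complex.normSq_apply]
  nlinarith [mul_self_nonneg (Y i i).im]

theorem fidelity_nonneg {d : ℕ} (ρ σ : Matrix (Fin d) (Fin d) ℂ) : 0 ≤ fidelity ρ σ :=
  (Complex.le_def.1 (Matrix.nonneg_iff_posSemidef.1 (CFC.sqrt_nonneg
    ((CFC.sqrt ρ * CFC.sqrt σ)ᴴ * (CFC.sqrt ρ * CFC.sqrt σ)))).trace_nonneg).1

/-- The easy half of Uhlmann's theorem: the trace norm of `L √σ` depends on `L` only through `Lᴴ *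
L`, so `L` may be replaced by `√ρ`. -/
theorem re_trace_mul_sqrt_le_fidelity {d : ℕ} {ρ : Matrix (Fin d) (Fin d) ℂ}
    (σ : Matrix (Fin d) (Fin d) ℂ) {L : Matrix (Fin d) (Fin d) ℂ} (hL : Lᴴ * L = ρ) :
    (L * CFC.sqrt σ).trace.re ≤ fidelity ρ σ := by
  refine (re_trace_le_traceNorm _).trans (le_of_eq ?_)
  have hρ : 0 ≤ ρ := hL ▸
    Matrix.nonneg_iff_posSemidef.2 (Matrix.posSemidef_conjTranspose_mul_self L)
  have hH : (CFC.sqrt ρ)ᴴ = CFC.sqrt ρ :=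
    (Matrix.nonneg_iff_posSemidef.1 (CFC.sqrt_nonneg ρ)).1
  have h : (L * CFC.sqrt σ)ᴴ * (L * CFC.sqrt σ) =
      (CFC.sqrt ρ * CFC.sqrt σ)ᴴ * (CFC.sqrt ρ * CFC.sqrt σ) := by
    calc _ = (CFC.sqrt σ)ᴴ * (Lᴴ * L) * CFC.sqrt σ := by
          simp only [Matrix.conjTranspose_mul, Matrix.mul_assoc]
      _ = (CFC.sqrt σ)ᴴ * (CFC.sqrt ρ * CFC.sqrt ρ) * CFC.sqrt σ := by
          rw [hL, CFC.sqrt_mul_sqrt_self ρ hρ]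
      _ = _ := by
          simp only [Matrix.conjTranspose_mul, Matrix.mul_assoc, hH]
  rw [fidelity, traceNorm, traceNorm, h]

theorem sqrt_conj_diagonal {I : Type*} [Fintype I] [DecidableEq I] {U : Matrix I I ℂ}
    (hU : Uᴴ * U = 1) {β : I → ℝ} (hβ : ∀ i, 0 ≤ β i) :
    CFC.sqrt (U * Matrix.diagonal (fun i => (β i : ℂ)) * Uᴴ) =
      U * Matrix.diagonal (fun i => (√(β i) : ℂ)) * Uᴴ := by
  apply CFC.sqrt_unique
  · calc _ = U * (Matrix.diagonal (fun i => (√(β i) : ℂ)) * (Uᴴ * U) *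
          Matrix.diagonal (fun i => (√(β i) : ℂ))) * Uᴴ := by simp only [Matrix.mul_assoc]
      _ = _ := by
        rw [hU, Matrix.mul_one, Matrix.diagonal_mul_diagonal]
        congr 3
        funext i
        rw [← Complex.ofReal_mul, Real.mul_self_sqrt (hβ i)]
  · exact Matrix.nonneg_iff_posSemidef.2 ((Matrix.PosSemidef.diagonal fun i =>
      Complex.zero_le_real.2 (Real.sqrt_nonneg _)).mul_mul_conjTranspose_same U)

/-- A purification of `ρ` whose squared distance from the standard purification of `diagonal b` is
at most the `χ²`-divergence. -/
theorem exists_purification {I : Type*} [Fintype I] [DecidableEq I] {b : I → ℝ}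
    (hb : ∀ i, 0 < b i) {ρ : Matrix I I ℂ} (hρ : ρ.PosSemidef) :
    ∃ L : Matrix I I ℂ, Lᴴ * L = ρ ∧
      ∑ i, ∑ j, Complex.normSq (L i j - Matrix.diagonal (fun i => (√(b i) : ℂ)) i j) ≤
        diagChiSq b ρ := by
  have hb' : ∀ i, (√(b i) : ℂ) ≠ 0 := fun i => by exact_mod_cast (Real.sqrt_pos.2 (hb i)).ne'
  set R := Matrix.diagonal (fun i => (√(b i) : ℂ)) with hR
  set T := Matrix.diagonal (fun i => (√(b i) : ℂ)⁻¹) with hT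
  set D := Matrix.diagonal (fun i => (b i : ℂ)) with hD
  have hRT : R * T = 1 := by
    rw [hR, hT, Matrix.diagonal_mul_diagonal, ← Matrix.diagonal_one]
    congr 1
    funext i
    exact mul_inv_cancel₀ (hb' i)
  have hTR : T * R = 1 := by
    rw [hR, hT, Matrix.diagonal_mul_diagonal, ← Matrix.diagonal_one]
    congr 1
    funext i
    exact inv_mul_cancel₀ (hb' i)
  have hRR : R * R = D := by
    rw [hR, hD, Matrix.diagonal_mul_diagonal]
    congr 1
    funext i
    rw [← Complex.ofReal_mul, Real.mul_self_sqrt (hb i).le]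
  have hRH : Rᴴ = R := Matrix.isHermitian_diagonal_of_self_adjoint _
    (funext fun i => Complex.conj_ofReal _)
  have hTH : Tᴴ = T := Matrix.isHermitian_diagonal_of_self_adjoint _
    (funext fun i => by
      rw [Pi.star_apply, Complex.star_def, ← Complex.ofReal_inv, Complex.conj_ofReal])
  have hDpos : D.PosSemidef := Matrix.PosSemidef.diagonal fun i =>
    Complex.zero_le_real.2 (hb i).le
  have hRρR : 0 ≤ R * ρ * R := by
    have := hρ.conjTranspose_mul_mul_same R
    rw [hRH] at this
    exact Matrix.nonneg_iff_posSemidef.2 this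
  set S := CFC.sqrt (R * ρ * R) with hS
  have hSS : S * S = R * ρ * R := CFC.sqrt_mul_sqrt_self _ hRρR
  have hSpos : S.PosSemidef := Matrix.nonneg_iff_posSemidef.1 (CFC.sqrt_nonneg _)
  -- The geometric mean of `D⁻¹` and `ρ`, which is the positive solution of `G D G = ρ`.
  set G := T * S * T with hG
  have hGpos : G.PosSemidef := by
    have := hSpos.conjTranspose_mul_mul_same T
    rwa [hTH] at this
  have hGDG : G * D * G = ρ := by
    calc G * D * G = T * S * (T * R) * (R * T) * S * T := by
          rw [← hRR, hG]; simp only [Matrix.mul_assoc]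
      _ = T * (S * S) * T := by
          rw [hTR, hRT, Matrix.mul_one, Matrix.mul_one]; simp only [Matrix.mul_assoc]
      _ = (T * R) * ρ * (R * T) := by rw [hSS]; simp only [Matrix.mul_assoc]
      _ = ρ := by rw [hTR, hRT, Matrix.one_mul, Matrix.mul_one]
  refine ⟨R * G, ?_, ?_⟩
  · rw [Matrix.conjTranspose_mul, hRH, hGpos.1.eq, ← hGDG, ← hRR]
    simp only [Matrix.mul_assoc]
  set N := G - 1 with hN
  have hGN : G = N + 1 := by rw [hN, sub_add_cancel]
  have hNH : N.IsHermitian := hGpos.1.sub Matrix.isHermitian_one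
  have hA : ρ - D = N * D + D * N + N * D * N := by
    rw [← hGDG, hGN]
    noncomm_ring
  have hg : ∑ i, ∑ j, Complex.normSq ((R * G) i j - R i j) = (N * D * N).trace.re := by
    have := trace_conjTranspose_mul_self (R * N)
    rw [Matrix.conjTranspose_mul, hRH, hNH.eq] at this
    have h2 : N * R * (R * N) = N * D * N := by rw [← hRR]; simp only [Matrix.mul_assoc]
    rw [← h2, this, hN, Matrix.mul_sub, Matrix.mul_one]
    rfl
  have hg' : (N * D * N).trace.re = ∑ i, ∑ j, (b i + b j) / 2 * Complex.normSq (N i j) := by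
    have h2 : ∀ i j, Complex.normSq (N i j) = Complex.normSq (N j i) := fun i j => by
      rw [← hNH.apply i j, Complex.star_def, Complex.normSq_conj]
    have h3 : (N * D * N).trace.re = ∑ i, ∑ j, b j * Complex.normSq (N i j) := by
      rw [Matrix.trace, Complex.re_sum]
      refine Finset.sum_congr rfl fun i _ => ?_
      rw [Matrix.diag_apply, Matrix.mul_apply, Complex.re_sum]
      refine Finset.sum_congr rfl fun j _ => ?_
      rw [hD, Matrix.mul_diagonal, ← hNH.apply j i, Complex.star_def, mul_right_comm, Complex.mul_conj,
        ← Complex.ofReal_mul, Complex.ofReal_re, mul_comm]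
    have h4 : ∑ i, ∑ j, b j * Complex.normSq (N i j) =
        ∑ i, ∑ j, b i * Complex.normSq (N i j) := by
      rw [Finset.sum_comm]
      exact Finset.sum_congr rfl fun i _ => Finset.sum_congr rfl fun j _ => by rw [h2]
    have h5 : ∑ i, ∑ j, (b i + b j) / 2 * Complex.normSq (N i j) =
        ((∑ i, ∑ j, b i * Complex.normSq (N i j)) +
          ∑ i, ∑ j, b j * Complex.normSq (N i j)) / 2 := by
      simp only [← Finset.sum_add_distrib, Finset.sum_div]
      exact Finset.sum_congr rfl fun i _ => Finset.sum_congr rfl fun j _ => by ring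
    rw [h5, h3, ← h4]
    ring
  -- The divergence is the Legendre dual of the quadratic form `tr (N D N)`; entry by entry this is
  -- completing the square.
  have hdual : 2 * ((ρ - D) * N).trace.re - (N * D * N).trace.re ≤ diagChiSq b ρ := by
    have h2 : ((ρ - D) * N).trace.re = ∑ i, ∑ j, ((ρ - D) i j * star (N i j)).re := by
      simp only [Matrix.trace, Matrix.diag_apply, Matrix.mul_apply, Complex.re_sum]
      exact Finset.sum_congr rfl fun i _ => Finset.sum_congr rfl fun j _ => by rw [hNH.apply]
    rw [h2, hg', diagChiSq, Finset.mul_sum, ← Finset.sum_sub_distrib]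
    refine Finset.sum_le_sum fun i _ => ?_
    rw [Finset.mul_sum, ← Finset.sum_sub_distrib]
    refine Finset.sum_le_sum fun j _ => ?_
    have hij : 0 < b i + b j := add_pos (hb i) (hb j)
    obtain ⟨x, hx⟩ : ∃ x, x = (ρ - D) i j := ⟨_, rfl⟩
    obtain ⟨y, hy⟩ : ∃ y, y = N i j := ⟨_, rfl⟩
    change _ ≤ 2 / (b i + b j) * Complex.normSq ((ρ - D) i j)
    rw [← hx, ← hy, div_mul_eq_mul_div 2 (b i + b j) (Complex.normSq x), le_div_iff₀ hij]
    simp only [Complex.normSq_apply, Complex.mul_re, Complex.star_def, Complex.conj_re,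
      Complex.conj_im]
    nlinarith [sq_nonneg (2 * x.re - (b i + b j) * y.re),
      sq_nonneg (2 * x.im - (b i + b j) * y.im)]
  -- By `hAN`, this makes `tr ((ρ - D) N)` at least `tr (N D N)`, so the left side of `hdual` is at
  -- least the squared distance `tr (N D N)`.
  have hpos : 0 ≤ (N * D * N * G).trace.re := by
    have := hDpos.conjTranspose_mul_mul_same N
    rw [hNH.eq] at this
    exact re_trace_mul_nonneg this hGpos
  have hAN : ((ρ - D) * N).trace = (N * D * N).trace + (N * D * N * G).trace := by
    have h2 : (D * N * N).trace = (N * D * N).trace := by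
      rw [Matrix.trace_mul_comm, ← Matrix.mul_assoc]
    rw [hA, hGN]
    simp only [Matrix.add_mul, Matrix.mul_add, Matrix.mul_one, Matrix.trace_add, h2]
    ring
  rw [hg]
  rw [hAN, Complex.add_re] at hdual
  linarith

/-! ### Comparison of `σ` with its mixture with the maximally mixed state -/

section mixing

variable {d : ℕ} {ρ σ U : Matrix (Fin d) (Fin d) ℂ} {β b : Fin d → ℝ} {η ε : ℝ}

/-- The left side is at most the squared Hilbert–Schmidt distance from a purification `L` of the
rotated `ρ` to `√β`. It is split at `√b`: the first leg is `exists_purification`, the second costs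
at most `∑ |b i - β i| ≤ 2 * η`. -/
theorem two_mul_one_sub_fidelity_le (hρ : IsState ρ) (hUU : Uᴴ * U = 1) (hUU' : U * Uᴴ = 1)
    (hσ : σ = U * Matrix.diagonal (fun i => (β i : ℂ)) * Uᴴ) (hβ : ∀ i, 0 ≤ β i)
    (hβ1 : ∑ i, β i = 1) (hη : 0 ≤ η) (hb : ∀ i, b i = (1 - η) * β i + η / d)
    (hb0 : ∀ i, 0 < b i) :
    2 * (1 - fidelity ρ σ) ≤ 1.001 * diagChiSq b (Uᴴ * ρ * U) + 2002 * η := by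
  have hρ' := hρ.conj hUU'
  obtain ⟨L, hL, hLb⟩ := exists_purification hb0 hρ'.posSemidef
  have hF : ∑ i, (L i i).re * √(β i) ≤ fidelity ρ σ := by
    have h1 : (U * L * Uᴴ)ᴴ * (U * L * Uᴴ) = ρ := by
      calc _ = U * Lᴴ * (Uᴴ * U) * L * Uᴴ := by
            simp only [Matrix.conjTranspose_mul, Matrix.conjTranspose_conjTranspose,
              Matrix.mul_assoc]
        _ = U * (Lᴴ * L) * Uᴴ := by rw [hUU, Matrix.mul_one]; simp only [Matrix.mul_assoc]
        _ = (U * Uᴴ) * ρ * (U * Uᴴ) := by rw [hL]; simp only [Matrix.mul_assoc]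
        _ = ρ := by rw [hUU', Matrix.one_mul, Matrix.mul_one]
    refine le_trans (le_of_eq ?_) (re_trace_mul_sqrt_le_fidelity σ h1)
    have h2 : U * L * Uᴴ * (U * Matrix.diagonal (fun i => (√(β i) : ℂ)) * Uᴴ) =
        U * (L * (Uᴴ * U) * Matrix.diagonal (fun i => (√(β i) : ℂ))) * Uᴴ := by
      simp only [Matrix.mul_assoc]
    rw [hσ, sqrt_conj_diagonal hUU hβ, h2, hUU, Matrix.mul_one, Matrix.trace_mul_cycle, hUU,
      Matrix.one_mul, Matrix.trace, Complex.re_sum]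
    refine Finset.sum_congr rfl fun i _ => ?_
    rw [Matrix.diag_apply, Matrix.mul_diagonal, Complex.re_mul_ofReal]
  have hL1 : ∑ i, ∑ j, Complex.normSq (L i j) = 1 := by
    rw [← trace_conjTranspose_mul_self, hL, hρ'.trace_eq_one, Complex.one_re]
  have hdist : ∑ i, ∑ j, Complex.normSq (L i j - Matrix.diagonal (fun i => (√(β i) : ℂ)) i j) =
      2 - 2 * ∑ i, (L i i).re * √(β i) := by
    have h1 : ∀ i, ∑ j, Complex.normSq (L i j - Matrix.diagonal (fun i => (√(β i) : ℂ)) i j) =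
        ∑ j, Complex.normSq (L i j) + (β i - 2 * ((L i i).re * √(β i))) := fun i => by
      rw [← sub_eq_iff_eq_add', ← Finset.sum_sub_distrib, Finset.sum_eq_single i]
      · rw [Matrix.diagonal_apply_eq, Complex.normSq_sub, Complex.conj_ofReal,
          Complex.re_mul_ofReal, Complex.normSq_ofReal, Real.mul_self_sqrt (hβ i)]
        ring
      · intro j _ hj
        rw [Matrix.diagonal_apply_ne _ hj.symm, sub_zero, sub_self]
      · simp
    simp only [h1, Finset.sum_add_distrib, Finset.sum_sub_distrib, hL1, hβ1, ← Finset.mul_sum]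
    ring
  have hmix : ∑ i, (√(b i) - √(β i)) ^ 2 ≤ 2 * η := by
    have h1 : ∀ i, (√(b i) - √(β i)) ^ 2 ≤ η * β i + η / d := fun i => by
      have h2 : (√(b i) - √(β i)) ^ 2 ≤ |b i - β i| := by
        have e1 := Real.mul_self_sqrt (hb0 i).le
        have e2 := Real.mul_self_sqrt (hβ i)
        have e3 := Real.sqrt_nonneg (b i)
        have e4 := Real.sqrt_nonneg (β i)
        have : b i - β i = (√(b i) - √(β i)) * (√(b i) + √(β i)) := by
          linear_combination e2 - e1
        rw [this, abs_mul, abs_of_nonneg (add_nonneg e3 e4), ← sq_abs, sq]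
        refine mul_le_mul_of_nonneg_left ?_ (abs_nonneg _)
        exact abs_le.2 ⟨by linarith, by linarith⟩
      refine h2.trans ?_
      have h3 : 0 ≤ η * β i := mul_nonneg hη (hβ i)
      have h4 : 0 ≤ η / d := by positivity
      rw [hb]
      exact abs_le.2 ⟨by linarith, by linarith⟩
    refine (Finset.sum_le_sum fun i _ => h1 i).trans ?_
    rw [Finset.sum_add_distrib, ← Finset.mul_sum, hβ1, Finset.sum_const, Finset.card_univ,
      Fintype.card_fin, nsmul_eq_mul]
    have : (d : ℝ) * (η / d) ≤ η := by
      rw [mul_div_left_comm]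
      exact mul_le_of_le_one_right hη (div_self_le_one _)
    linarith
  have htri : ∑ i, ∑ j, Complex.normSq (L i j - Matrix.diagonal (fun i => (√(β i) : ℂ)) i j) ≤
      1.001 * ∑ i, ∑ j, Complex.normSq (L i j - Matrix.diagonal (fun i => (√(b i) : ℂ)) i j) +
        1001 * ∑ i, (√(b i) - √(β i)) ^ 2 := by
    rw [Finset.mul_sum, Finset.mul_sum, ← Finset.sum_add_distrib]
    refine Finset.sum_le_sum fun i _ => ?_
    have h1 : (√(b i) - √(β i)) ^ 2 = ∑ j, Complex.normSq
        (Matrix.diagonal (fun i => (√(b i) : ℂ)) i j -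
          Matrix.diagonal (fun i => (√(β i) : ℂ)) i j) := by
      rw [Finset.sum_eq_single i]
      · rw [Matrix.diagonal_apply_eq, Matrix.diagonal_apply_eq, ← Complex.ofReal_sub,
          Complex.normSq_ofReal, sq]
      · intro j _ hj
        rw [Matrix.diagonal_apply_ne _ hj.symm, Matrix.diagonal_apply_ne _ hj.symm, sub_zero,
          map_zero]
      · simp
    rw [h1, Finset.mul_sum, Finset.mul_sum, ← Finset.sum_add_distrib]
    refine Finset.sum_le_sum fun j _ => ?_
    refine le_trans (le_of_eq ?_) (normSq_add_le _ _)
    rw [sub_add_sub_cancel]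
  linarith

/-- In an eigenbasis of `σ` the equation for `Ω` decouples into entries. Where `β i + β j = 0` it
forces the entry of `ρ - σ` to vanish, so the value `2 / 0 = 0` in the sum hides nothing. -/
theorem sum_le_of_buresChiSq_le (hρ : IsState ρ) (hσs : IsState σ) (hUU : Uᴴ * U = 1)
    (hUU' : U * Uᴴ = 1) (hσ : σ = U * Matrix.diagonal (fun i => (β i : ℂ)) * Uᴴ)
    {c : ℝ} (h : buresChiSq ρ σ ≤ (c : EReal)) :
    (∀ i j, β i + β j = 0 →
      (Uᴴ * ρ * U) i j - Matrix.diagonal (fun i => (β i : ℂ)) i j = 0) ∧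
    ∑ i, ∑ j, 2 / (β i + β j) * Complex.normSq
      ((Uᴴ * ρ * U) i j - Matrix.diagonal (fun i => (β i : ℂ)) i j) ≤ c := by
  set D := Matrix.diagonal (fun i => (β i : ℂ)) with hD
  unfold buresChiSq at h
  split_ifs at h with hker
  swap
  · exact absurd h (by simp)
  have h := EReal.coe_le_coe_iff.1 h
  have hX := omegaInv_omega (A := ρ - σ) hσs.posSemidef fun v hv => by
    rw [Matrix.sub_mulVec, hv, hker v hv, sub_zero]
  set X := omega σ (ρ - σ) with hXdef
  set Y := Uᴴ * X * U with hY
  have hDσ : Uᴴ * σ * U = D := by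
    rw [hσ]
    calc _ = (Uᴴ * U) * D * (Uᴴ * U) := by simp only [Matrix.mul_assoc]
      _ = D := by rw [hUU, Matrix.one_mul, Matrix.mul_one]
  have hA : Uᴴ * (ρ - σ) * U = Uᴴ * ρ * U - D := by
    rw [Matrix.mul_sub, Matrix.sub_mul, hDσ]
  set A := Uᴴ * ρ * U - D with hAdef
  have hAH : A.IsHermitian := by
    rw [← hA]
    exact Matrix.isHermitian_conjTranspose_mul_mul U
      (hρ.posSemidef.1.sub hσs.posSemidef.1)
  have hDY : (1 / 2 : ℂ) • (D * Y + Y * D) = A := by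
    have e1 : D * Y = Uᴴ * (σ * X) * U := by
      calc D * Y = Uᴴ * σ * (U * Uᴴ) * X * U := by
            rw [← hDσ, hY]; simp only [Matrix.mul_assoc]
        _ = _ := by rw [hUU', Matrix.mul_one]; simp only [Matrix.mul_assoc]
    have e2 : Y * D = Uᴴ * (X * σ) * U := by
      calc Y * D = Uᴴ * X * (U * Uᴴ) * σ * U := by
            rw [← hDσ, hY]; simp only [Matrix.mul_assoc]
        _ = _ := by rw [hUU', Matrix.mul_one]; simp only [Matrix.mul_assoc]
    rw [e1, e2, ← hA, ← hX, omegaInv, ← Matrix.add_mul, ← Matrix.mul_add, Matrix.mul_smul,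
      Matrix.smul_mul]
  have hent : ∀ i j, (((β i + β j) / 2 : ℝ) : ℂ) * Y i j = A i j := fun i j => by
    rw [← hDY, Matrix.smul_apply, Matrix.add_apply, hD, Matrix.diagonal_mul,
      Matrix.mul_diagonal, smul_eq_mul]
    push_cast
    ring
  have hzero : ∀ i j, β i + β j = 0 → A i j = 0 := fun i j hij => by
    rw [← hent, hij]
    simp
  refine ⟨hzero, le_trans (le_of_eq ?_) h⟩
  have htr : ((ρ - σ) * X).trace = (A * Y).trace := by
    rw [← hA, hY]
    calc _ = ((U * Uᴴ) * ((ρ - σ) * X)).trace := by rw [hUU', Matrix.one_mul]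
      _ = (Uᴴ * ((ρ - σ) * X) * U).trace := by
        rw [Matrix.mul_assoc, Matrix.trace_mul_comm]
      _ = (Uᴴ * (ρ - σ) * (U * Uᴴ) * X * U).trace := by
        rw [hUU', Matrix.mul_one]; simp only [Matrix.mul_assoc]
      _ = _ := by simp only [Matrix.mul_assoc]
  rw [htr]
  simp only [Matrix.trace, Matrix.diag_apply, Matrix.mul_apply (M := A), Complex.re_sum]
  refine Finset.sum_congr rfl fun i _ => Finset.sum_congr rfl fun j _ => ?_
  change _ * Complex.normSq (A i j) = _
  by_cases hij : β i + β j = 0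
  · rw [hzero i j hij]
    simp
  · have h2 : A i j * Y j i = ((2 / (β i + β j) * Complex.normSq (A i j) : ℝ) : ℂ) := by
      have h3 := hent j i
      rw [← hAH.apply j i, Complex.star_def] at h3
      have hij' : (β i : ℂ) + β j ≠ 0 := by exact_mod_cast hij
      push_cast at h3 ⊢
      rw [← Complex.mul_conj, ← h3]
      field_simp
      ring
    rw [h2, Complex.ofReal_re]

theorem diagChiSq_le_of_buresChiSq_le (hρ : IsState ρ) (hσs : IsState σ) (hUU : Uᴴ * U = 1)
    (hUU' : U * Uᴴ = 1) (hσ : σ = U * Matrix.diagonal (fun i => (β i : ℂ)) * Uᴴ)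
    (hβ : ∀ i, 0 ≤ β i) (hβ1 : ∑ i, β i = 1) (hη : 0 < η) (hη1 : η ≤ 1 / 2)
    (hb : ∀ i, b i = (1 - η) * β i + η / d) (hb0 : ∀ i, 0 < b i)
    {c : ℝ} (h : buresChiSq ρ σ ≤ (c : EReal)) :
    diagChiSq b (Uᴴ * ρ * U) ≤ 1.001 / (1 - η) * c + 3003 * η := by
  obtain ⟨hzero, hsum⟩ := sum_le_of_buresChiSq_le hρ hσs hUU hUU' hσ h
  have hd : 0 ≤ η / d := by positivity
  -- The numerator is at most `(η * β i) ^ 2 + (η / d) ^ 2`, while `b i` is at least `β i / 2` and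
  -- at least `η / d`.
  have hmix : ∀ i, (β i - b i) ^ 2 / b i ≤ 2 * η * β i + η / d := fun i => by
    rw [div_le_iff₀ (hb0 i), hb]
    have := hβ i
    nlinarith [mul_nonneg hη.le (mul_nonneg this this), mul_nonneg this hd,
      mul_nonneg (mul_nonneg hη.le this) hd,
      mul_nonneg (sub_nonneg.2 hη1) (mul_nonneg hη.le (mul_nonneg this this)),
      mul_nonneg (sub_nonneg.2 hη1) (mul_nonneg this hd)]
  have hmixsum : ∑ i, (β i - b i) ^ 2 / b i ≤ 3 * η := by
    refine (Finset.sum_le_sum fun i _ => hmix i).trans ?_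
    rw [Finset.sum_add_distrib, ← Finset.mul_sum, hβ1, Finset.sum_const, Finset.card_univ,
      Fintype.card_fin, nsmul_eq_mul]
    have : (d : ℝ) * (η / d) ≤ η := by
      rw [mul_div_left_comm]
      exact mul_le_of_le_one_right hη.le (div_self_le_one _)
    linarith
  have hη2 : 0 < 1 - η := by linarith
  have hterm : ∀ i j, 2 / (b i + b j) * Complex.normSq
      ((Uᴴ * ρ * U) i j - Matrix.diagonal (fun i => (b i : ℂ)) i j) ≤
      1.001 / (1 - η) * (2 / (β i + β j) * Complex.normSq
        ((Uᴴ * ρ * U) i j - Matrix.diagonal (fun i => (β i : ℂ)) i j)) +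
      1001 * (2 / (b i + b j) * Complex.normSq (Matrix.diagonal (fun i => (β i : ℂ)) i j -
        Matrix.diagonal (fun i => (b i : ℂ)) i j)) := fun i j => by
    have hbij : 0 < b i + b j := add_pos (hb0 i) (hb0 j)
    have h1 := normSq_add_le ((Uᴴ * ρ * U) i j - Matrix.diagonal (fun i => (β i : ℂ)) i j)
      (Matrix.diagonal (fun i => (β i : ℂ)) i j - Matrix.diagonal (fun i => (b i : ℂ)) i j)
    rw [sub_add_sub_cancel] at h1
    have h2 := mul_le_mul_of_nonneg_left h1 (div_nonneg zero_le_two hbij.le)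
    -- Uses `b i ≥ (1 - η) * β i`, or the vanishing of the entry when `β i + β j = 0`.
    have h3 : 2 / (b i + b j) * Complex.normSq
        ((Uᴴ * ρ * U) i j - Matrix.diagonal (fun i => (β i : ℂ)) i j) ≤
        (1 / (1 - η)) * (2 / (β i + β j) * Complex.normSq
        ((Uᴴ * ρ * U) i j - Matrix.diagonal (fun i => (β i : ℂ)) i j)) := by
      by_cases hij : β i + β j = 0
      · rw [hzero i j hij]
        simp
      · have hij' : 0 < β i + β j := lt_of_le_of_ne (add_nonneg (hβ i) (hβ j)) (Ne.symm hij)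
        rw [← mul_assoc]
        refine mul_le_mul_of_nonneg_right ?_ (Complex.normSq_nonneg _)
        rw [div_mul_div_comm, one_mul]
        refine div_le_div_of_nonneg_left zero_le_two (by positivity) ?_
        rw [hb i, hb j]
        linarith
    calc _ ≤ _ := h2
      _ = 1.001 * (2 / (b i + b j) * Complex.normSq
        ((Uᴴ * ρ * U) i j - Matrix.diagonal (fun i => (β i : ℂ)) i j)) + 1001 *
        (2 / (b i + b j) * Complex.normSq (Matrix.diagonal (fun i => (β i : ℂ)) i j -
        Matrix.diagonal (fun i => (b i : ℂ)) i j)) := by ring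
      _ ≤ 1.001 * ((1 / (1 - η)) * (2 / (β i + β j) * Complex.normSq
        ((Uᴴ * ρ * U) i j - Matrix.diagonal (fun i => (β i : ℂ)) i j))) + _ := by gcongr
      _ = _ := by ring
  have hdiag : ∀ i, ∑ j, 2 / (b i + b j) * Complex.normSq
      (Matrix.diagonal (fun i => (β i : ℂ)) i j - Matrix.diagonal (fun i => (b i : ℂ)) i j) =
      (β i - b i) ^ 2 / b i := fun i => by
    rw [Finset.sum_eq_single i]
    · rw [Matrix.diagonal_apply_eq, Matrix.diagonal_apply_eq, ← Complex.ofReal_sub,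
        Complex.normSq_ofReal]
      have := (hb0 i).ne'
      field_simp
      ring
    · intro j _ hj
      rw [Matrix.diagonal_apply_ne _ hj.symm, Matrix.diagonal_apply_ne _ hj.symm, sub_zero,
        map_zero, mul_zero]
    · simp
  have hfin := Finset.sum_le_sum (s := Finset.univ) fun i _ =>
    Finset.sum_le_sum (s := Finset.univ) fun j _ => hterm i j
  simp only [Finset.sum_add_distrib, ← Finset.mul_sum, hdiag] at hfin
  have h4 : 1.001 / (1 - η) * ∑ i, ∑ j, 2 / (β i + β j) * Complex.normSq
      ((Uᴴ * ρ * U) i j - Matrix.diagonal (fun i => (β i : ℂ)) i j) ≤ 1.001 / (1 - η) * c :=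
    mul_le_mul_of_nonneg_left hsum (by positivity)
  change diagChiSq b (Uᴴ * ρ * U) ≤ _ at hfin
  linarith

end mixing

/-! ### The certification test -/

/-- The two-outcome measurement that reports `far` with the effect `E`. -/
def effectPOVM {I : Type*} [Fintype I] [DecidableEq I] {E : Matrix I I ℂ} (h0 : E.PosSemidef)
    (h1 : (1 - E).PosSemidef) : POVM I Verdict where
  op v := match v with
    | .close => 1 - E
    | .far => E
  posSemidef v := match v with
    | .close => h1
    | .far => h0
  sum_eq_one := by
    have : (Finset.univ : Finset Verdict) = {.close, .far} := rfl
    rw [this, Finset.sum_pair (by decide)]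
    exact sub_add_cancel 1 E

theorem effectPOVM_prob {I : Type*} [Fintype I] [DecidableEq I] {E : Matrix I I ℂ}
    (h0 : E.PosSemidef) (h1 : (1 - E).PosSemidef) {ϱ : Matrix I I ℂ} (hϱ : IsState ϱ)
    (S : Set Verdict) :
    (effectPOVM h0 h1).prob ϱ S =
      S.indicator (fun _ => 1 - (ϱ * E).trace.re) .close +
        S.indicator (fun _ => (ϱ * E).trace.re) .far := by
  have : (Finset.univ : Finset Verdict) = {.close, .far} := rfl
  rw [POVM.prob, this, Finset.sum_pair (by decide)]
  have h2 : (ϱ * (1 - E)).trace.re = 1 - (ϱ * E).trace.re := by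
    rw [Matrix.mul_sub, Matrix.trace_sub, Matrix.mul_one, hϱ.trace_eq_one, Complex.sub_re,
      Complex.one_re]
  classical
  simp only [Set.indicator_apply]
  congr 1
  rw [← h2]
  rfl

/-- The real square root is zero on negative numbers; keeping the maximum makes it unnecessary to
know that the fidelity is at most one. -/
theorem buresDist_sq {d : ℕ} (ρ σ : Matrix (Fin d) (Fin d) ℂ) :
    buresDist ρ σ ^ 2 = max (2 * (1 - fidelity ρ σ)) 0 := by
  rw [buresDist, Real.sq_sqrt']

/-- The first guarantee follows from the other two: "far" is wrong only for small divergence, and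
"close" only when the fidelity is below `1 - ε`, hence the Bures distance large. By `hdisj` at most
one of the two reports can be wrong. -/
theorem exists_POVM_of_hasTest {d n : ℕ} {σ : Matrix (Fin d) (Fin d) ℂ} {ε δ : ℝ} (hε : 0 < ε)
    (hδ : 0 < δ)
    (h : HasTest (Fin n) (fun ρ => buresChiSq ρ σ ≤ ((0.49 * ε : ℝ) : EReal))
      (fun ρ => 0.5 * ε < buresDist ρ σ ^ 2) δ)
    (hdisj : ∀ ρ, IsState ρ → buresChiSq ρ σ ≤ ((0.49 * ε : ℝ) : EReal) →
      buresDist ρ σ ^ 2 ≤ 0.5 * ε) :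
    ∃ M : POVM (Fin n → Fin d) Verdict, ∀ ρ : Matrix (Fin d) (Fin d) ℂ, IsState ρ →
      1 - δ ≤ M.prob (copies n ρ)
        {v | (v = Verdict.close → 1 - ε ≤ fidelity ρ σ) ∧
          (v = Verdict.far → ((0.49 * ε : ℝ) : EReal) < buresChiSq ρ σ)} ∧
      (buresChiSq ρ σ ≤ ((0.49 * ε : ℝ) : EReal) →
        1 - δ ≤ M.prob (copies n ρ) {Verdict.close}) ∧
      (0.5 * ε < buresDist ρ σ ^ 2 → 1 - δ ≤ M.prob (copies n ρ) {Verdict.far}) := by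
  obtain ⟨E, h0, h1, hE⟩ := h
  refine ⟨effectPOVM h0 h1, fun ρ hρ => ?_⟩
  have hs : IsState (copies n ρ) := IsState.tensor (J := Fin n) fun _ => hρ
  obtain ⟨hclose, hfar⟩ := hE ρ hρ
  change _ → (copies n ρ * E).trace.re ≤ δ at hclose
  change _ → 1 - δ ≤ (copies n ρ * E).trace.re at hfar
  have hp0 : 0 ≤ (copies n ρ * E).trace.re := re_trace_mul_nonneg hs.posSemidef h0
  have hp1 : (copies n ρ * E).trace.re ≤ 1 := by
    have := re_trace_mul_nonneg hs.posSemidef h1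
    rw [Matrix.mul_sub, Matrix.trace_sub, Matrix.mul_one, hs.trace_eq_one, Complex.sub_re,
      Complex.one_re] at this
    linarith
  have hfid : buresDist ρ σ ^ 2 ≤ 0.5 * ε → 1 - ε ≤ fidelity ρ σ := fun h => by
    rw [buresDist_sq] at h
    linarith [le_max_left (2 * (1 - fidelity ρ σ)) 0]
  simp only [effectPOVM_prob h0 h1 hs]
  classical
  refine ⟨?_, fun h => ?_, fun h => ?_⟩
  · simp only [Set.indicator_apply, Set.mem_ofPred_eq, reduceCtorEq, false_implies, true_implies,
      and_true, true_and]
    by_cases ha : buresChiSq ρ σ ≤ ((0.49 * ε : ℝ) : EReal)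
    · rw [if_pos (hfid (hdisj ρ hρ ha)), if_neg (not_lt.2 ha)]
      linarith [hclose ha]
    · rw [if_pos (not_le.1 ha)]
      split_ifs with hb
      · linarith
      · linarith [hfar (lt_of_not_ge fun h => hb (hfid h))]
  · simp only [Set.indicator_apply, Set.mem_singleton_iff, reduceCtorEq, if_true, if_false]
    linarith [hclose h]
  · simp only [Set.indicator_apply, Set.mem_singleton_iff, reduceCtorEq, if_true, if_false]
    linarith [hfar h]

/-- Both halves of the test for `σ` are decided by the `χ²`-divergence from the full-rank state
obtained by mixing `σ` with the maximally mixed state. -/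
theorem exists_smoothing {d : ℕ} {σ : Matrix (Fin d) (Fin d) ℂ} (hσ : IsState σ) {ε : ℝ}
    (hε : 0 < ε) (hε4 : ε < 4) (hd : 0 < d) :
    ∃ (U : Matrix (Fin d) (Fin d) ℂ) (b : Fin d → ℝ), U * Uᴴ = 1 ∧ ∑ i, b i = 1 ∧
      (∀ i, 1e-8 * ε / d ≤ b i) ∧ ∀ ρ, IsState ρ →
        (buresChiSq ρ σ ≤ ((0.49 * ε : ℝ) : EReal) →
          diagChiSq b (Uᴴ * ρ * U) ≤ 0.491 * ε) ∧
        (0.5 * ε < buresDist ρ σ ^ 2 → 0.499 * ε ≤ diagChiSq b (Uᴴ * ρ * U)) := by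
  obtain ⟨U, β, h1, h2, hU⟩ := exists_unitary_diagonal hσ.posSemidef.1
  have hD : Uᴴ * σ * U = Matrix.diagonal fun i => (β i : ℂ) := by
    rw [hU]
    calc _ = (Uᴴ * U) * Matrix.diagonal (fun i => (β i : ℂ)) * (Uᴴ * U) := by
          simp only [Matrix.mul_assoc]
      _ = _ := by rw [h1, Matrix.one_mul, Matrix.mul_one]
  have hDs := hσ.conj h2
  rw [hD] at hDs
  have hβ : ∀ i, 0 ≤ β i := fun i => by
    have := hDs.posSemidef.diag_nonneg (i := i)
    rw [Matrix.diagonal_apply_eq] at this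
    exact Complex.zero_le_real.1 this
  have hβ1 : ∑ i, β i = 1 := by
    have := hDs.trace_eq_one
    rw [Matrix.trace_diagonal] at this
    exact_mod_cast this
  have hd' : (0 : ℝ) < d := by exact_mod_cast hd
  obtain ⟨η, hη⟩ : ∃ η, η = 1e-8 * ε := ⟨_, rfl⟩
  have hη0 : 0 < η := by rw [hη]; positivity
  have hη1 : η ≤ 4e-8 := by rw [hη]; linarith
  have hηd : 0 < η / d := by positivity
  have hb : ∀ i, η / d ≤ (1 - η) * β i + η / d := fun i => by
    have := mul_nonneg (by linarith : 0 ≤ 1 - η) (hβ i)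
    linarith
  have hb0 := fun i => hηd.trans_le (hb i)
  refine ⟨U, fun i => (1 - η) * β i + η / d, h2, ?_, fun i => hη ▸ hb i, fun ρ hρ => ⟨fun h => ?_,
    fun h => ?_⟩⟩
  · rw [Finset.sum_add_distrib, ← Finset.mul_sum, hβ1, Finset.sum_const, Finset.card_univ,
      Fintype.card_fin, nsmul_eq_mul]
    field_simp
    ring
  · refine (diagChiSq_le_of_buresChiSq_le hρ hσ h1 h2 hU hβ hβ1 hη0 (by linarith)
      (fun _ => rfl) hb0 h).trans ?_
    -- The margin is `1.0011 * 0.49 + 3003e-8 < 0.491`; in the other case it is `0.5 - 2002e-8 >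
    -- 1.001 * 0.499`.
    have : 1.001 / (1 - η) ≤ 1.0011 := by
      rw [div_le_iff₀ (by linarith)]
      linarith
    have := mul_le_mul_of_nonneg_right this (by positivity : 0 ≤ 0.49 * ε)
    linarith
  · have h3 := two_mul_one_sub_fidelity_le hρ h1 h2 hU hβ hβ1 hη0.le (fun _ => rfl) hb0
    rw [buresDist_sq, lt_max_iff] at h
    rcases h with h | h <;> linarith

theorem half_pow_ceil_le {δ : ℝ} (hδ : 0 < δ) :
    (1 / 2 : ℝ) ^ ⌈2 * Real.log (1 / δ)⌉₊ ≤ δ := by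
  -- This is where the factor `2` in the number of repetitions comes from.
  have h1 : (1 / 2 : ℝ) ≤ Real.exp (-(1 / 2)) := by
    have := Real.add_one_le_exp (-(1 / 2) : ℝ)
    linarith
  calc (1 / 2 : ℝ) ^ ⌈2 * Real.log (1 / δ)⌉₊ ≤ Real.exp (-(1 / 2)) ^ ⌈2 * Real.log (1 / δ)⌉₊ := by
        gcongr
    _ = Real.exp (⌈2 * Real.log (1 / δ)⌉₊ * (-(1 / 2))) := (Real.exp_nat_mul _ _).symm
    _ ≤ Real.exp (Real.log δ) := by
        apply Real.exp_le_exp.2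
        have := Nat.le_ceil (2 * Real.log (1 / δ))
        rw [one_div, Real.log_inv] at this ⊢
        linarith
    _ = δ := Real.exp_log hδ

end QCert

end

/-! ### Assembly -/

theorem theorem1 :
    ∃ C : ℝ, 0 < C ∧
      ∀ (d : ℕ) (σ : Matrix (Fin d) (Fin d) ℂ), QCert.IsState σ →
      ∀ ε : ℝ, 0 < ε →
      ∀ δ : ℝ, 0 < δ → δ ≤ 1 / 3 →
        ∃ n : ℕ, (n : ℝ) ≤ C * ((d : ℝ) / ε) * Real.log (1 / δ) ∧
          ∃ M : QCert.POVM (Fin n → Fin d) QCert.Verdict,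
            ∀ ρ : Matrix (Fin d) (Fin d) ℂ, QCert.IsState ρ →
              1 - δ ≤ M.prob (QCert.copies n ρ)
                {v | (v = QCert.Verdict.close → 1 - ε ≤ QCert.fidelity ρ σ) ∧
                  (v = QCert.Verdict.far →
                    ((0.49 * ε : ℝ) : EReal) < QCert.buresChiSq ρ σ)} ∧
              (QCert.buresChiSq ρ σ ≤ ((0.49 * ε : ℝ) : EReal) →
                1 - δ ≤ M.prob (QCert.copies n ρ) {QCert.Verdict.close}) ∧
              (0.5 * ε < QCert.buresDist ρ σ ^ 2 →
                1 - δ ≤ M.prob (QCert.copies n ρ) {QCert.Verdict.far}) := by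
  refine ⟨1e17, by norm_num, fun d σ hσ ε hε δ hδ hδ3 => ?_⟩
  -- Since `δ ≤ 1/3 < 1/e`; this absorbs the rounding of the number of repetitions.
  have hlog : 1 ≤ Real.log (1 / δ) := by
    rw [Real.le_log_iff_exp_le (by positivity)]
    refine Real.exp_one_lt_d9.le.trans ?_
    rw [le_div_iff₀ hδ]
    linarith
  rcases le_or_gt 4 ε with hε4 | hε4
  -- For `ε ≥ 4` the squared Bures distance, at most `2`, never exceeds `0.5 * ε`, so "close" may be
  -- reported on zero copies. Otherwise `d / ε ≥ 1/4`, which absorbs the rounding of `k`.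
  · have hdist : ∀ ρ : Matrix (Fin d) (Fin d) ℂ, QCert.buresDist ρ σ ^ 2 ≤ 0.5 * ε := fun ρ => by
      rw [QCert.buresDist_sq]
      have := QCert.fidelity_nonneg ρ σ
      exact max_le (by linarith) (by positivity)
    refine ⟨0, by rw [Nat.cast_zero]; positivity, QCert.exists_POVM_of_hasTest hε hδ
      ⟨0, Matrix.PosSemidef.zero, by rw [sub_zero]; exact Matrix.PosSemidef.one,
        fun ρ _ => ⟨fun _ => ?_, fun h => absurd h (not_lt.2 (hdist ρ))⟩⟩ fun ρ _ _ => hdist ρ⟩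
    rw [Matrix.mul_zero, Matrix.trace_zero, Complex.zero_re]
    exact hδ.le
  have hd : 0 < d := by
    rcases Nat.eq_zero_or_pos d with h | h
    · subst h
      have := hσ.trace_eq_one
      simp [Matrix.trace] at this
    · exact h
  have hd1 : (1 : ℝ) ≤ d := by exact_mod_cast hd
  obtain ⟨U, b, hU, hb1, hb, hρb⟩ := QCert.exists_smoothing hσ hε hε4 hd
  have htest := ((QCert.hasTest_diagChiSq hb1 hε (by rwa [Fintype.card_fin])
    (by rwa [Fintype.card_fin]) (k := ⌈1e16 * ((Fintype.card (Fin d) : ℝ) / ε)⌉₊)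
    (Nat.le_ceil _)).amplify ⌈2 * Real.log (1 / δ)⌉₊).conj hU
  rw [Fintype.card_fin] at htest
  set k := ⌈1e16 * ((d : ℝ) / ε)⌉₊ with hk
  set m := ⌈2 * Real.log (1 / δ)⌉₊ with hm
  refine ⟨m * (k + k), ?_, QCert.exists_POVM_of_hasTest hε hδ ((htest.mono
    (fun ρ hρ => (hρb ρ hρ).1) (fun ρ hρ => (hρb ρ hρ).2) (QCert.half_pow_ceil_le hδ)).congr
    (Fintype.equivFinOfCardEq (by simp))) fun ρ hρ h => ?_⟩
  · have hx : 1 / 4 ≤ (d : ℝ) / ε := by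
      rw [div_le_div_iff₀ (by norm_num) hε]
      linarith
    have h1 : (k : ℝ) ≤ 1.1e16 * (d / ε) := by
      have := Nat.ceil_lt_add_one (by positivity : (0 : ℝ) ≤ 1e16 * (d / ε))
      rw [← hk] at this
      linarith
    have h2 : (m : ℝ) ≤ 3 * Real.log (1 / δ) := by
      have := Nat.ceil_lt_add_one (by positivity : (0 : ℝ) ≤ 2 * Real.log (1 / δ))
      rw [← hm] at this
      linarith
    push_cast
    calc (m : ℝ) * (k + k) ≤ (3 * Real.log (1 / δ)) *
          (1.1e16 * (d / ε) + 1.1e16 * (d / ε)) := by gcongr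
      _ = 6.6e16 * (d / ε) * Real.log (1 / δ) := by ring
      _ ≤ 1e17 * (d / ε) * Real.log (1 / δ) := by gcongr; norm_num
  -- The divergence from the smoothed state cannot be both at most `0.491 * ε` and at least `0.499 *
  -- ε`.
  · by_contra hcon
    have h1 := (hρb ρ hρ).1 h
    have h2 := (hρb ρ hρ).2 (not_le.1 hcon)
    linarith
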